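/- Let $d\ge 1$, let $X\subset\mathbb R^d$ be compact with the Euclidean metric, and for each $n\ge1$ let $\Phi_n=\{\phi_{n,j}\}_{j=1}^{N_n}$, $2\le N_n<\infty$, be maps $\phi_{n,j}:X\to X$ of the form $$\phi_{n,j}(x)=r_{n,j}O_{n,j}(x+\alpha_{n,j}),\qquad r_{n,j}\in(0,1),\ O_{n,j}\ \text{orthogonal},\ \alpha_{n,j}\in\mathbb R^d .$$ Assume that $\{\Phi_n\}_{n\ge1}$ is a Moran-type iterated function system (MIFS): there are constants $0<c_{1,n}\le c_{2,n}<1$ with $\prod_{i=1}^n c_{2,i}\to0$ and $c_{1,n}\|x-y\|\le\|\phi_{n,j}(x)-\phi_{n,j}(y)\|\le c_{2,n}\|x-y\|$ for all $x,y\in X$, $n\ge1$, $1\le j\le N_n$. For a word $J=j_nj_{n+1}\cdots j_{n+k-1}$ with $1\le j_i\le N_i$ put $\phi_{n,J}=\phi_{n,j_n}\circ\cdots\circ\phi_{n+k-1,j_{n+k-1}}$ (the identity of $X$ if $k=0$) and $|J|=k$. For words $J$ starting at layer $1$ put $R_J=\max\{\|\phi_{1,J}(x)-\phi_{1,J}(y)\|/\|x-y\|: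 x\ne y\in X\}$. For $b>0$ let $$\mathcal I_b=\{j_1\cdots j_m:\ m\ge1,\ R_{j_1\cdots j_m}\le b<R_{j_1\cdots j_{m-1}}\},\qquad \mathcal A_b=\{\phi_{1,J}:J\in\mathcal I_b\},$$ where $\mathcal A_b$ is a set of maps on $X$, so coinciding maps are counted once. Let $K_n$ be the set of all limits $\lim_{k\to\infty}\phi_{n,j_nj_{n+1}\cdots j_{n+k}}(a)$ with $1\le j_i\le N_i$ for $i\ge n$ (these limits do not depend on $a\in X$). Assume the Moran-type weak separation condition: there are Lebesgue measurable sets $U_n\subseteq X$, $n\ge1$, with $\inf_n\mathcal L^d(U_n)>0$ and $$\sup_{0<b<1}\ \max_{I\in\mathcal I_b}\ \#\{\phi_{1,J}:\ J\in\mathcal I_b,\ \phi_{1,J}(U_{|J|+1})\cap\phi_{1,I}(U_{|I|+1})\ne\emptyset\}<\infty .$$ Let $\underline{\dim}_{\rm B}$, $\overline{\dim}_{\rm B}$ and $\dim_{\rm P}$ denote the lower box, upper box and packing dimension. (i) If $r_0:=\inf\{r_{n,j}:n\ge1,\ 1\le j\le N_n\}>0$, then for all $n\ge1$ $$\underline{\dim}_{\rm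 B}K_n=\liminf_{b\to0^+}\frac{\ln\#\mathcal A_b}{-\ln b}\le\limsup_{b\to0^+}\frac{\ln\#\mathcal A_b}{-\ln b}=\overline{\dim}_{\rm B}K_n=\dim_{\rm P}K_n .$$ (ii) If $r_{n,j}=r_n$ for all $n\ge1$ and $1\le j\le N_n$, and $\lim_{n\to\infty}\dfrac{\ln r_n}{\ln(r_1r_2\cdots r_{n-1})}=0$, then for all $n\ge1$ $$\underline{\dim}_{\rm B}K_n=\liminf_{b\to0^+}\frac{\ln\#\mathcal A_b}{-\ln b}=\liminf_{m\to\infty}\frac{\ln\#\mathcal A_{r_1\cdots r_m}}{-\ln(r_1\cdots r_m)},$$ $$\overline{\dim}_{\rm B}K_n=\dim_{\rm P}K_n=\limsup_{b\to0^+}\frac{\ln\#\mathcal A_b}{-\ln b}=\limsup_{m\to\infty}\frac{\ln\#\mathcal A_{r_1\cdots r_m}}{-\ln(r_1\cdots r_m)} .$$ -/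

import Mathlib

open Set Filter Topology MeasureTheory
open scoped ENNReal NNReal

/-! ### Box dimensions and packing dimension -/

section Dimensions

variable {E : Type*} [MetricSpace E]

/-- Lower box dimension `liminf_{δ → 0⁺} log N_δ(F) / (- log δ)`, where `N_δ(F)` is the smallest
number of closed balls of radius `δ` that cover `F`. It takes values in the extended reals. -/
noncomputable def lowerBoxDim (F : Set E) : EReal :=
  liminf (fun δ : ℝ≥0 =>
    ENNReal.log ((Metric.externalCoveringNumber δ F : ℕ∞) : ℝ≥0∞) / ((-Real.log δ : ℝ) : EReal))
    (𝓝[>] 0)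

/-- Upper box dimension `limsup_{δ → 0⁺} log N_δ(F) / (- log δ)`. -/
noncomputable def upperBoxDim (F : Set E) : EReal :=
  limsup (fun δ : ℝ≥0 =>
    ENNReal.log ((Metric.externalCoveringNumber δ F : ℕ∞) : ℝ≥0∞) / ((-Real.log δ : ℝ) : EReal))
    (𝓝[>] 0)

/-- `P^s_δ(F)`: the supremum of `∑ (2 rᵢ)^s` over all `δ`-packings of `F`, that is, families of
pairwise disjoint closed balls of radii `0 < rᵢ ≤ δ` with centres in `F`. A ball is recorded as the
pair (centre, radius). Finite packings give the same supremum as countable ones. -/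
noncomputable def packingPreDelta (s : ℝ≥0) (δ : ℝ) (F : Set E) : ℝ≥0∞ :=
  ⨆ (t : Finset (E × ℝ)) (_ : ∀ p ∈ t, p.1 ∈ F ∧ 0 < p.2 ∧ p.2 ≤ δ)
    (_ : (t : Set (E × ℝ)).PairwiseDisjoint (fun p => Metric.closedBall p.1 p.2)),
    ∑ p ∈ t, ENNReal.ofReal (2 * p.2) ^ (s : ℝ)

/-- The packing premeasure `P^s_0(F) = lim_{δ → 0⁺} P^s_δ(F) = inf_{δ > 0} P^s_δ(F)`. -/
noncomputable def packingPremeasure (s : ℝ≥0) (F : Set E) : ℝ≥0∞ :=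
  ⨅ (δ : ℝ) (_ : 0 < δ), packingPreDelta s δ F

/-- The `s`-dimensional packing measure
`P^s(F) = inf {∑ᵢ P^s_0(Fᵢ) : F ⊆ ⋃ᵢ Fᵢ}`, over countable covers. -/
noncomputable def packingMeasure (s : ℝ≥0) (F : Set E) : ℝ≥0∞ :=
  ⨅ (t : ℕ → Set E) (_ : F ⊆ ⋃ i, t i), ∑' i, packingPremeasure s (t i)

/-- Packing dimension `sup {s ≥ 0 : P^s(F) = ∞}`. -/
noncomputable def packingDim (F : Set E) : ℝ≥0∞ :=
  ⨆ (s : ℝ≥0) (_ : packingMeasure s F = ⊤), (s : ℝ≥0∞)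

end Dimensions

/-! ### Moran-type iterated function systems

Layers are indexed from `0`: the layer `n` below is the layer `n + 1` of a system indexed from `1`. -/

/-- Words `j_n j_{n+1} ⋯ j_{n+k-1}` of length `k` starting from the layer `n`, where the letter of
the layer `i` is one of `N i` symbols. -/
inductive MoranWord (N : ℕ → ℕ) : ℕ → ℕ → Type
  | nil {n : ℕ} : MoranWord N n 0
  | cons {n k : ℕ} (j : Fin (N n)) (J : MoranWord N (n + 1) k) : MoranWord N n (k + 1)

namespace MoranWord

variable {N : ℕ → ℕ}

/-- Delete the last letter of a nonempty word. -/
def dropLast : {n k : ℕ} → MoranWord N n (k + 1) → MoranWord N n k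
  | _, 0, _ => nil
  | _, _ + 1, cons j J => cons j (dropLast J)

/-- The word `σ_n σ_{n+1} ⋯ σ_{n+k-1}` read off an infinite sequence of letters. -/
def take (σ : ∀ i, Fin (N i)) : (n k : ℕ) → MoranWord N n k
  | _, 0 => nil
  | n, k + 1 => cons (σ n) (take σ (n + 1) k)

end MoranWord

/-- A Moran-type iterated function system on a compact subset `X` of `ℝ^d` with the Euclidean
metric: the layer `n` consists of `N n ≥ 2` maps from `X` to itself with Lipschitz bounds
`0 < c₁ n ≤ c₂ n < 1`, and `c₂ 0 ⋯ c₂ (n-1) → 0`. -/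
structure MIFS {d : ℕ} (X : Set (EuclideanSpace ℝ (Fin d))) where
  isCompact : IsCompact X
  N : ℕ → ℕ
  two_le_N : ∀ n, 2 ≤ N n
  map : (n : ℕ) → Fin (N n) → X → X
  bilipschitz : ∃ c₁ c₂ : ℕ → ℝ,
    (∀ n, 0 < c₁ n ∧ c₁ n ≤ c₂ n ∧ c₂ n < 1) ∧
    Tendsto (fun n => ∏ i ∈ Finset.range n, c₂ i) atTop (𝓝 0) ∧
    ∀ n j x y, c₁ n * dist x y ≤ dist (map n j x) (map n j y) ∧
      dist (map n j x) (map n j y) ≤ c₂ n * dist x y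

namespace MIFS

variable {d : ℕ} {X : Set (EuclideanSpace ℝ (Fin d))} (S : MIFS X)

/-- `φ_{n,J} = φ_{n,j_n} ∘ φ_{n+1,j_{n+1}} ∘ ⋯ ∘ φ_{n+k-1,j_{n+k-1}}`. -/
def wordMap : {n k : ℕ} → MoranWord S.N n k → X → X
  | _, _, .nil => id
  | n, _, .cons j J => S.map n j ∘ wordMap J

/-- The Moran-type invariant set `K_n`: all limits of `φ_{n, σ_n ⋯ σ_{n+k-1}}(a)` as `k → ∞`. -/
def attractor (n : ℕ) : Set (EuclideanSpace ℝ (Fin d)) :=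
  {x | ∃ (σ : ∀ i, Fin (S.N i)) (a : X),
    Tendsto (fun k => (S.wordMap (MoranWord.take σ n k) a : EuclideanSpace ℝ (Fin d)))
      atTop (𝓝 x)}

/-- The largest ratio `R_J` of the map `φ_J`. -/
noncomputable def ratio {n k : ℕ} (J : MoranWord S.N n k) : ℝ :=
  sSup {q | ∃ x y : X, x ≠ y ∧ q = dist (S.wordMap J x) (S.wordMap J y) / dist x y}

/-- The words `J = j_1 ⋯ j_m`, `m ≥ 1`, from the initial layer on, with
`R_{j_1 ⋯ j_m} ≤ b < R_{j_1 ⋯ j_{m-1}}`. The pair `⟨k, J⟩` is a word of length `k + 1`. -/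
def cutWords (b : ℝ) : Set (Σ k, MoranWord S.N 0 (k + 1)) :=
  {J | S.ratio J.2 ≤ b ∧ b < S.ratio J.2.dropLast}

/-- `A_b`, the set of the maps `φ_J` on `X` with `J` in `cutWords b`. Different words may give the
same map, which is then counted once. -/
def cutMaps (b : ℝ) : Set (X → X) :=
  (fun J => S.wordMap J.2) '' S.cutWords b

/-- `ln #A_b / (- ln b)`, in the extended reals. -/
noncomputable def cutQuotient (b : ℝ) : EReal :=
  ENNReal.log (((S.cutMaps b).encard : ℕ∞) : ℝ≥0∞) / ((-Real.log b : ℝ) : EReal)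

/-- The Moran-type weak separation condition. The set attached to a word of length `k + 1` is
`U (k + 1)`, the one of the first layer after the word. -/
def MWSC : Prop :=
  ∃ U : ℕ → Set X,
    (∀ n, NullMeasurableSet ((↑) '' U n : Set (EuclideanSpace ℝ (Fin d))) volume) ∧
    0 < ⨅ n, volume ((↑) '' U n : Set (EuclideanSpace ℝ (Fin d))) ∧
    ∃ γ : ℕ, ∀ b ∈ Ioo (0 : ℝ) 1, ∀ I ∈ S.cutWords b,
      {f : X → X | ∃ J ∈ S.cutWords b, S.wordMap J.2 = f ∧
        (S.wordMap J.2 '' U (J.1 + 1) ∩ S.wordMap I.2 '' U (I.1 + 1)).Nonempty}.encard ≤ γ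

end MIFS

/-! The proof compares the box count `N_δ` of the attractor of the initial layer with the number of
maps in `A_b`. Every point of this attractor lies in `f(X)` for some `f` in `A_b`, and these images
have diameter at most `b * diam X`; hence `N_{Db} ≤ #A_b` for `D ≥ diam X`
(`boxCount_le_encard_cutMaps`). Conversely, let all ratios of the cut at `b` lie in `[p, C * p]`. If
`f(X)` meets a given ball of radius `p`, then the copy `f(U)` lies in a concentric ball of
comparable radius and has volume at least a constant times `p ^ d`, while the separation condition
lets only boundedly many such copies share a point. Comparing volumes bounds the number of these
maps (`exists_encard_hitting_le`), so `#A_b ≤ M * N_p` (`exists_encard_cutMaps_le`).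

Exponents do not see bounded factors, nor a change of scale from `x` to `y` with `log x / log y → 1`
(`GrowthDominated`). In case (i) one takes `p = r₀ * b`. In case (ii) all words of the cut have the
same length, `p` is their common ratio, and the hypothesis on logarithms makes `p` logarithmically
equivalent to `b`. `CutScales` treats both cases at once.

Each `K_n` is a finite union of similar copies of `K_{n+1}`, so its box dimensions do not depend on
`n`. For the packing dimension, Baire's theorem on the space of codes shows that some member of a
countable closed cover of `K_n` contains a similar copy of some `K_{n+k}`, and so has full upper box
dimension. As closures keep the upper box dimension, every countable cover has a piece whose packing
premeasure is infinite at each smaller exponent. -/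

/-! ### Comparing growth rates -/

section Growth

variable {ι κ : Type*} {l : Filter ι}

/-- The exponent `log A / (- log x)` of a count `A` at the scale `x`. -/
noncomputable def growth (A : ℕ∞) (x : ℝ) : EReal :=
  ENNReal.log (A : ℝ≥0∞) / ((-Real.log x : ℝ) : EReal)

lemma growth_natCast {n : ℕ} (hn : n ≠ 0) (x : ℝ) :
    growth n x = ((Real.log n / (-Real.log x) : ℝ) : EReal) := by
  rw [growth, EReal.coe_div]
  congr 1
  simp [ENNReal.log, hn]

lemma growth_mono_left {A B : ℕ∞} (h : A ≤ B) {x : ℝ} (hx0 : 0 < x) (hx1 : x < 1) :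
    growth A x ≤ growth B x := by
  have := Real.log_neg hx0 hx1
  refine EReal.div_le_div_right_of_nonneg ?_ (ENNReal.log_le_log (by exact_mod_cast h))
  exact_mod_cast (by linarith : 0 ≤ -Real.log x)

lemma liminf_le_liminf_comp {u : κ → EReal} {m : Filter κ} {h : ι → κ} (hh : Tendsto h l m) :
    liminf u m ≤ liminf (fun i => u (h i)) l := by
  have : liminf u m ≤ liminf u (map h l) := liminf_le_liminf_of_le hh
  simpa [liminf, Filter.map_map, Function.comp_def] using this

lemma limsup_comp_le_limsup {u : κ → EReal} {m : Filter κ} {h : ι → κ} (hh : Tendsto h l m) :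
    limsup (fun i => u (h i)) l ≤ limsup u m := by
  have : limsup u (map h l) ≤ limsup u m := limsup_le_limsup_of_le hh
  simpa [limsup, Filter.map_map, Function.comp_def] using this

/-- In the application `ρ` is the quotient of the logarithms of two scales and `ε` the trace of a
multiplicative constant. The gap between `c` and `c'` absorbs both, so `u` and `v` need not be
bounded. -/
lemma eventually_lt_of_mul_le_add {u v ρ ε : ι → ℝ} (h : ∀ᶠ i in l, u i * ρ i ≤ v i + ε i)
    (hρ : Tendsto ρ l (𝓝 1)) (hε : Tendsto ε l (𝓝 0)) {c c' : ℝ} (hc : c < c') :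
    ∀ᶠ i in l, v i < c → u i < c' := by
  have h1 : Tendsto (fun i => c + ε i) l (𝓝 (c + 0)) := tendsto_const_nhds.add hε
  have h2 : Tendsto (fun i => c' * ρ i) l (𝓝 (c' * 1)) := tendsto_const_nhds.mul hρ
  filter_upwards [h, h1.eventually_lt h2 (by simpa using hc), hρ.eventually (lt_mem_nhds one_pos)]
    with i hi h3 h4 h5
  exact lt_of_mul_lt_mul_right (by linarith) h4.le

lemma liminf_coe_le_of_mul_le_add {u v ρ ε : ι → ℝ} (h : ∀ᶠ i in l, u i * ρ i ≤ v i + ε i)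
    (hρ : Tendsto ρ l (𝓝 1)) (hε : Tendsto ε l (𝓝 0)) :
    liminf (fun i => (u i : EReal)) l ≤ liminf (fun i => (v i : EReal)) l := by
  by_contra! hlt
  obtain ⟨c, hc1, hc2⟩ := EReal.lt_iff_exists_real_btwn.1 hlt
  obtain ⟨c', hc3, hc4⟩ := EReal.lt_iff_exists_real_btwn.1 hc2
  have hf := frequently_lt_of_liminf_lt (by isBoundedDefault) hc1
  have he := eventually_lt_of_lt_liminf hc4
  obtain ⟨i, ⟨hi1, hi2⟩, hi3⟩ := ((hf.and_eventually (eventually_lt_of_mul_le_add h hρ hε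
    (EReal.coe_lt_coe_iff.1 hc3))).and_eventually he).exists
  exact absurd (hi2 (EReal.coe_lt_coe_iff.1 hi1)) (not_lt.2 (EReal.coe_lt_coe_iff.1 hi3).le)

lemma limsup_coe_le_of_mul_le_add {u v ρ ε : ι → ℝ} (h : ∀ᶠ i in l, u i * ρ i ≤ v i + ε i)
    (hρ : Tendsto ρ l (𝓝 1)) (hε : Tendsto ε l (𝓝 0)) :
    limsup (fun i => (u i : EReal)) l ≤ limsup (fun i => (v i : EReal)) l := by
  by_contra! hlt
  obtain ⟨c, hc1, hc2⟩ := EReal.lt_iff_exists_real_btwn.1 hlt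
  obtain ⟨c', hc3, hc4⟩ := EReal.lt_iff_exists_real_btwn.1 hc2
  have hf := frequently_lt_of_lt_limsup (by isBoundedDefault) hc4
  have he := eventually_lt_of_limsup_lt hc1
  obtain ⟨i, ⟨hi1, hi2⟩, hi3⟩ := ((hf.and_eventually (eventually_lt_of_mul_le_add h hρ hε
    (EReal.coe_lt_coe_iff.1 hc3))).and_eventually he).exists
  exact absurd (hi2 (EReal.coe_lt_coe_iff.1 hi3)) (not_lt.2 (EReal.coe_lt_coe_iff.1 hi1).le)

/-- Two counts that agree up to a bounded factor, at logarithmically equivalent scales. -/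
structure GrowthDominated (l : Filter ι) (A : ι → ℕ∞) (x : ι → ℝ) (B : ι → ℕ∞) (y : ι → ℝ) :
    Prop where
  ne_zero : ∀ᶠ i in l, A i ≠ 0
  le : ∃ C : ℕ, ∀ᶠ i in l, A i ≤ C * B i
  ne_top : ∀ᶠ i in l, B i ≠ ⊤
  tendsto : Tendsto y l (𝓝[>] 0)
  ratio : Tendsto (fun i => Real.log (x i) / Real.log (y i)) l (𝓝 1)

namespace GrowthDominated

variable {A B : ι → ℕ∞} {x y : ι → ℝ}

/-- Since `A ≠ 0`, `B ≠ ⊤` and `A ≤ C * B`, both counts are finite and nonzero, so all logarithms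
are real. Multiplying `log A / (-log x)` by `log x / log y` trades the scale `x` for `y`; what
remains is `log A ≤ log C + log B`. -/
lemma exists_real (h : GrowthDominated l A x B y) :
    ∃ u v ρ ε : ι → ℝ, (∀ᶠ i in l, u i * ρ i ≤ v i + ε i) ∧ Tendsto ρ l (𝓝 1) ∧
      Tendsto ε l (𝓝 0) ∧ (∀ᶠ i in l, growth (A i) (x i) = (u i : EReal)) ∧
      ∀ᶠ i in l, growth (B i) (y i) = (v i : EReal) := by
  obtain ⟨C, hC⟩ := h.le
  have hlog : Tendsto (fun i => Real.log (y i)) l atBot :=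
    Real.tendsto_log_nhdsGT_zero.comp h.tendsto
  have key : ∀ᶠ i in l, ∃ a b : ℕ, A i = a ∧ B i = b ∧ a ≠ 0 ∧ b ≠ 0 ∧ C ≠ 0 ∧ a ≤ C * b := by
    filter_upwards [h.ne_zero, hC, h.ne_top] with i h0 h1 h2
    obtain ⟨b, hb⟩ := ENat.ne_top_iff_exists.1 h2
    have hA : A i ≠ ⊤ := by
      intro hA
      rw [hA, ← hb, top_le_iff] at h1
      exact ENat.natCast_ne_top (C * b) (by exact_mod_cast h1)
    obtain ⟨a, ha⟩ := ENat.ne_top_iff_exists.1 hA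
    rw [← ha, ← hb] at h1
    have h1' : a ≤ C * b := by exact_mod_cast h1
    have ha0 : a ≠ 0 := by
      rintro rfl
      exact h0 (by simp [← ha])
    refine ⟨a, b, ha.symm, hb.symm, ha0, ?_, ?_, h1'⟩ <;> rintro rfl <;> simp at h1' <;>
      exact ha0 h1'
  refine ⟨fun i => Real.log (A i).toNat / (-Real.log (x i)),
    fun i => Real.log (B i).toNat / (-Real.log (y i)),
    fun i => Real.log (x i) / Real.log (y i), fun i => Real.log C / (-Real.log (y i)),
    ?_, h.ratio, ?_, ?_, ?_⟩
  · filter_upwards [key, hlog.eventually_lt_atBot 0,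
      h.ratio.eventually (lt_mem_nhds one_pos)] with i ⟨a, b, ha, hb, ha0, hb0, hC0, hab⟩ hy hr
    -- The quotient of logarithms is eventually positive, whereas a zero numerator would make it
    -- zero.
    have hx : Real.log (x i) ≠ 0 := by
      intro h0
      simp [h0] at hr
    have hlogle : Real.log a ≤ Real.log C + Real.log b := by
      rw [← Real.log_mul (by positivity) (by positivity)]
      exact Real.log_le_log (by positivity) (by exact_mod_cast hab)
    have e1 : Real.log a / (-Real.log (x i)) * (Real.log (x i) / Real.log (y i)) =
        Real.log a / (-Real.log (y i)) := by
      field_simp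
    simp only [ha, hb, ENat.toNat_natCast]
    rw [e1, ← add_div]
    gcongr
    · linarith
    · linarith
  · exact (tendsto_neg_atBot_atTop.comp hlog).const_div_atTop _
  · filter_upwards [key] with i ⟨a, b, ha, hb, ha0, hb0, hC0, hab⟩
    rw [ha, growth_natCast ha0, ENat.toNat_natCast]
  · filter_upwards [key] with i ⟨a, b, ha, hb, ha0, hb0, hC0, hab⟩
    rw [hb, growth_natCast hb0, ENat.toNat_natCast]

lemma liminf_le (h : GrowthDominated l A x B y) :
    liminf (fun i => growth (A i) (x i)) l ≤ liminf (fun i => growth (B i) (y i)) l := by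
  obtain ⟨u, v, ρ, ε, h1, h2, h3, h4, h5⟩ := h.exists_real
  rw [liminf_congr h4, liminf_congr h5]
  exact liminf_coe_le_of_mul_le_add h1 h2 h3

lemma limsup_le (h : GrowthDominated l A x B y) :
    limsup (fun i => growth (A i) (x i)) l ≤ limsup (fun i => growth (B i) (y i)) l := by
  obtain ⟨u, v, ρ, ε, h1, h2, h3, h4, h5⟩ := h.exists_real
  rw [limsup_congr h4, limsup_congr h5]
  exact limsup_coe_le_of_mul_le_add h1 h2 h3

end GrowthDominated

lemma tendsto_const_mul_nhdsGT_zero {c : ℝ} (hc : 0 < c) :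
    Tendsto (fun b : ℝ => c * b) (𝓝[>] 0) (𝓝[>] 0) := by
  refine tendsto_nhdsWithin_iff.2 ⟨?_, ?_⟩
  · have : Tendsto (fun b : ℝ => c * b) (𝓝 0) (𝓝 (c * 0)) := tendsto_id.const_mul c
    rw [mul_zero] at this
    exact this.mono_left nhdsWithin_le_nhds
  · filter_upwards [self_mem_nhdsWithin] with b hb using mul_pos hc hb

lemma tendsto_log_const_mul_div_log {c : ℝ} (hc : 0 < c) :
    Tendsto (fun b : ℝ => Real.log (c * b) / Real.log b) (𝓝[>] 0) (𝓝 1) := by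
  have h : Tendsto (fun b : ℝ => Real.log c / Real.log b + 1) (𝓝[>] 0) (𝓝 (0 + 1)) :=
    (Real.tendsto_log_nhdsGT_zero.const_div_atBot _).add_const 1
  rw [zero_add] at h
  refine h.congr' ?_
  filter_upwards [self_mem_nhdsWithin, Real.tendsto_log_nhdsGT_zero.eventually_lt_atBot 0]
    with b hb hl
  rw [Real.log_mul hc.ne' (ne_of_gt hb), add_div, div_self hl.ne]

lemma tendsto_log_div_log_const_mul {c : ℝ} (hc : 0 < c) :
    Tendsto (fun b : ℝ => Real.log b / Real.log (c * b)) (𝓝[>] 0) (𝓝 1) := by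
  have := (tendsto_log_const_mul_div_log hc).inv₀ one_ne_zero
  simpa using this

end Growth

/-! ### Box dimensions -/

section BoxDim

variable {E : Type*} [MetricSpace E]

/-- The least number of closed balls of radius `δ` that cover `F`. -/
noncomputable def boxCount (F : Set E) (δ : ℝ) : ℕ∞ :=
  Metric.externalCoveringNumber δ.toNNReal F

lemma tendsto_coe_nhdsGT_zero : Tendsto ((↑) : ℝ≥0 → ℝ) (𝓝[>] 0) (𝓝[>] 0) := by
  refine tendsto_nhdsWithin_iff.2 ⟨?_, ?_⟩
  · exact (NNReal.continuous_coe.tendsto 0).mono_left nhdsWithin_le_nhds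
  · filter_upwards [self_mem_nhdsWithin] with b hb using hb

lemma tendsto_toNNReal_nhdsGT_zero : Tendsto Real.toNNReal (𝓝[>] 0) (𝓝[>] 0) := by
  refine tendsto_nhdsWithin_iff.2 ⟨?_, ?_⟩
  · have := (continuous_real_toNNReal.tendsto 0).mono_left (nhdsWithin_le_nhds (s := Ioi (0 : ℝ)))
    simpa using this
  · filter_upwards [self_mem_nhdsWithin] with b hb using Real.toNNReal_pos.2 hb

/-- The coercion and `Real.toNNReal` carry the scales in `ℝ≥0` and in `ℝ` tending to `0` into each
other; each of them gives one inequality. -/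
lemma lowerBoxDim_eq (F : Set E) :
    lowerBoxDim F = liminf (fun δ => growth (boxCount F δ) δ) (𝓝[>] 0) := by
  refine le_antisymm ?_ ?_
  · refine (liminf_le_liminf_comp tendsto_toNNReal_nhdsGT_zero).trans_eq (liminf_congr ?_)
    filter_upwards [self_mem_nhdsWithin] with b hb
    rw [growth, boxCount, Real.coe_toNNReal b (le_of_lt hb)]
  · refine (liminf_le_liminf_comp tendsto_coe_nhdsGT_zero).trans_eq (liminf_congr ?_)
    filter_upwards with b
    rw [growth, boxCount, Real.toNNReal_coe]

lemma upperBoxDim_eq (F : Set E) :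
    upperBoxDim F = limsup (fun δ => growth (boxCount F δ) δ) (𝓝[>] 0) := by
  refine le_antisymm ?_ ?_
  · refine le_trans (le_of_eq (limsup_congr ?_)) (limsup_comp_le_limsup tendsto_coe_nhdsGT_zero)
    filter_upwards with b
    rw [growth, boxCount, Real.toNNReal_coe]
  · refine le_trans (le_of_eq (limsup_congr ?_))
      (limsup_comp_le_limsup tendsto_toNNReal_nhdsGT_zero)
    filter_upwards [self_mem_nhdsWithin] with b hb
    rw [growth, boxCount, Real.coe_toNNReal b (le_of_lt hb)]

lemma boxCount_ne_zero {F : Set E} (hF : F.Nonempty) (δ : ℝ) : boxCount F δ ≠ 0 := by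
  rw [boxCount, ne_eq, Metric.externalCoveringNumber_eq_zero]
  exact hF.ne_empty

lemma boxCount_ne_top {F : Set E} (hF : TotallyBounded F) {δ : ℝ} (hδ : 0 < δ) :
    boxCount F δ ≠ ⊤ := by
  obtain ⟨C, -, hC, hcov⟩ :=
    Metric.exists_finite_isCover_of_totallyBounded (Real.toNNReal_pos.2 hδ).ne' hF
  exact ne_top_of_le_ne_top (encard_ne_top_iff.2 hC) hcov.externalCoveringNumber_le_encard

lemma boxCount_anti (F : Set E) {δ δ' : ℝ} (h : δ ≤ δ') : boxCount F δ' ≤ boxCount F δ :=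
  Metric.externalCoveringNumber_anti (Real.toNNReal_le_toNNReal h)

lemma boxCount_mono {F F' : Set E} (h : F ⊆ F') (δ : ℝ) : boxCount F δ ≤ boxCount F' δ :=
  Metric.externalCoveringNumber_mono_set h

lemma boxCount_le_encard {F C : Set E} {δ : ℝ}
    (h : F ⊆ ⋃ y ∈ C, Metric.closedBall y δ) : boxCount F δ ≤ C.encard := by
  refine Metric.IsCover.externalCoveringNumber_le_encard
    (Metric.isCover_iff_subset_iUnion_closedBall.2 (h.trans ?_))
  exact iUnion₂_mono fun y _ => Metric.closedBall_subset_closedBall (Real.le_coe_toNNReal δ)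

lemma exists_boxCount_eq_encard {F : Set E} {δ : ℝ} (hδ : 0 ≤ δ) :
    ∃ C : Set E, F ⊆ ⋃ y ∈ C, Metric.closedBall y δ ∧ C.encard = boxCount F δ := by
  have : Nonempty {C : Set E // Metric.IsCover δ.toNNReal F C} := ⟨F, Metric.IsCover.rfl⟩
  obtain ⟨⟨C, hC⟩, h⟩ := ENat.exists_eq_iInf
    fun C : {C : Set E // Metric.IsCover δ.toNNReal F C} => C.1.encard
  refine ⟨C, ?_, ?_⟩
  · simpa [Real.coe_toNNReal δ hδ] using hC.subset_iUnion_closedBall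
  · exact h.trans iInf_subtype

/-- A similarity of ratio `ρ`, onto the whole space. -/
structure IsSimilarity (ρ : ℝ) (G : E → E) : Prop where
  pos : 0 < ρ
  dist_eq : ∀ x y, dist (G x) (G y) = ρ * dist x y
  surjective : Function.Surjective G

/-- The centres of a cover need not lie in `F`; surjectivity of `G` on the whole space is what
allows them all to be pulled back. -/
lemma IsSimilarity.boxCount_le {ρ : ℝ} {G : E → E} (hG : IsSimilarity ρ G) {A F : Set E}
    (h : G '' A ⊆ F) {δ : ℝ} (hδ : 0 ≤ δ) : boxCount A δ ≤ boxCount F (ρ * δ) := by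
  obtain ⟨C, hC, hcard⟩ := exists_boxCount_eq_encard (F := F) (mul_nonneg hG.pos.le hδ)
  rw [← hcard]
  refine (boxCount_le_encard (C := Function.surjInv hG.surjective '' C) ?_).trans
    (encard_image_le _ _)
  intro x hx
  obtain ⟨y, hy, hxy⟩ := mem_iUnion₂.1 (hC (h (mem_image_of_mem G hx)))
  refine mem_iUnion₂.2 ⟨_, mem_image_of_mem _ hy, ?_⟩
  rw [Metric.mem_closedBall] at hxy ⊢
  rw [← Function.surjInv_eq hG.surjective y, hG.dist_eq] at hxy
  exact le_of_mul_le_mul_left hxy hG.pos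

lemma IsSimilarity.boxCount_image_le {ρ : ℝ} {G : E → E} (hG : IsSimilarity ρ G) (A : Set E)
    {δ : ℝ} (hδ : 0 ≤ δ) : boxCount (G '' A) (ρ * δ) ≤ boxCount A δ := by
  obtain ⟨C, hC, hcard⟩ := exists_boxCount_eq_encard (F := A) hδ
  rw [← hcard]
  refine (boxCount_le_encard (C := G '' C) ?_).trans (encard_image_le _ _)
  rintro _ ⟨x, hx, rfl⟩
  obtain ⟨y, hy, hxy⟩ := mem_iUnion₂.1 (hC hx)
  refine mem_iUnion₂.2 ⟨_, mem_image_of_mem _ hy, ?_⟩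
  rw [Metric.mem_closedBall] at hxy ⊢
  rw [hG.dist_eq]
  exact mul_le_mul_of_nonneg_left hxy hG.pos.le

lemma boxCount_iUnion_le {κ : Type*} [Fintype κ] (A : κ → Set E) {δ : ℝ} (hδ : 0 ≤ δ) :
    boxCount (⋃ i, A i) δ ≤ ∑ i, boxCount (A i) δ := by
  choose C hC hcard using fun i => exists_boxCount_eq_encard (F := A i) hδ
  simp_rw [← hcard]
  refine (boxCount_le_encard (C := ⋃ i, C i) ?_).trans ?_
  · refine iUnion_subset fun i => (hC i).trans ?_
    exact biUnion_mono (subset_iUnion C i) fun _ _ => le_rfl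
  · have : ∀ s : Finset κ, (⋃ i ∈ s, C i).encard ≤ ∑ i ∈ s, (C i).encard := by
      classical
      intro s
      induction s using Finset.induction_on with
      | empty => simp
      | insert a s ha ih =>
        rw [Finset.set_biUnion_insert, Finset.sum_insert ha]
        exact (encard_union_le _ _).trans (by gcongr)
    simpa using this Finset.univ

lemma IsSimilarity.lowerBoxDim_le {ρ : ℝ} {G : E → E} (hG : IsSimilarity ρ G) {A F : Set E}
    (h : G '' A ⊆ F) (hA : A.Nonempty) (hF : TotallyBounded F) :
    lowerBoxDim A ≤ lowerBoxDim F := by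
  rw [lowerBoxDim_eq, lowerBoxDim_eq]
  -- A change of scale can only raise a `liminf` and only lower a `limsup`. So the rescaled count
  -- stands on the smaller side for lower dimensions, and on the larger side for upper ones.
  have hdom : GrowthDominated (𝓝[>] (0 : ℝ)) (fun b => boxCount A (ρ⁻¹ * b)) (fun b => ρ⁻¹ * b)
      (fun b => boxCount F b) (fun b => b) := by
    refine ⟨?_, ⟨1, ?_⟩, ?_, tendsto_id, tendsto_log_const_mul_div_log (inv_pos.2 hG.pos)⟩
    · filter_upwards with b using boxCount_ne_zero hA _
    · filter_upwards [self_mem_nhdsWithin] with b hb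
      have := hG.boxCount_le h (mul_nonneg (inv_pos.2 hG.pos).le (le_of_lt hb))
      rw [mul_inv_cancel_left₀ hG.pos.ne'] at this
      simpa using this
    · filter_upwards [self_mem_nhdsWithin] with b hb using boxCount_ne_top hF hb
  exact (liminf_le_liminf_comp (u := fun b => growth (boxCount A b) b)
    (tendsto_const_mul_nhdsGT_zero (inv_pos.2 hG.pos))).trans
    hdom.liminf_le

lemma IsSimilarity.upperBoxDim_le {ρ : ℝ} {G : E → E} (hG : IsSimilarity ρ G) {A F : Set E}
    (h : G '' A ⊆ F) (hA : A.Nonempty) (hF : TotallyBounded F) :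
    upperBoxDim A ≤ upperBoxDim F := by
  rw [upperBoxDim_eq, upperBoxDim_eq]
  have hdom : GrowthDominated (𝓝[>] (0 : ℝ)) (fun b => boxCount A b) (fun b => b)
      (fun b => boxCount F (ρ * b)) (fun b => ρ * b) := by
    refine ⟨?_, ⟨1, ?_⟩, ?_, tendsto_const_mul_nhdsGT_zero hG.pos,
      tendsto_log_div_log_const_mul hG.pos⟩
    · filter_upwards with b using boxCount_ne_zero hA _
    · filter_upwards [self_mem_nhdsWithin] with b hb
      simpa using hG.boxCount_le h (le_of_lt hb)
    · filter_upwards [self_mem_nhdsWithin] with b hb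
      exact boxCount_ne_top hF (mul_pos hG.pos hb)
  exact hdom.limsup_le.trans (limsup_comp_le_limsup
    (u := fun b => growth (boxCount F b) b) (tendsto_const_mul_nhdsGT_zero hG.pos))

/-- A set that is a union of finitely many contracted copies of another one. -/
lemma growthDominated_boxCount_iUnion_image {κ : Type*} [Fintype κ] {ρ : κ → ℝ} {G : κ → E → E}
    (hG : ∀ i, IsSimilarity (ρ i) (G i)) (hρ : ∀ i, ρ i ≤ 1) {A F : Set E}
    (h : F = ⋃ i, G i '' A) (hF : F.Nonempty) (hA : TotallyBounded A) :
    GrowthDominated (𝓝[>] (0 : ℝ)) (fun b => boxCount F b) (fun b => b)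
      (fun b => boxCount A b) (fun b => b) := by
  refine ⟨?_, ⟨Fintype.card κ, ?_⟩, ?_, tendsto_id,
    by simpa using tendsto_log_const_mul_div_log one_pos⟩
  · filter_upwards with b using boxCount_ne_zero hF _
  · filter_upwards [self_mem_nhdsWithin] with b hb
    have hb' : (0 : ℝ) ≤ b := le_of_lt hb
    rw [h]
    refine (boxCount_iUnion_le _ hb').trans ?_
    calc ∑ i, boxCount (G i '' A) b ≤ ∑ _i : κ, boxCount A b := by
          refine Finset.sum_le_sum fun i _ => ?_
          exact (boxCount_anti _ (mul_le_of_le_one_left hb' (hρ i))).trans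
            ((hG i).boxCount_image_le A hb')
      _ = Fintype.card κ * boxCount A b := by simp
  · filter_upwards [self_mem_nhdsWithin] with b hb using boxCount_ne_top hA hb

end BoxDim

/-! ### Packing dimension and upper box dimension -/

lemma log_ofReal_rpow_neg {b : ℝ} (hb : 0 < b) (c : ℝ) :
    ENNReal.log (ENNReal.ofReal (b ^ (-c))) = ((c * -Real.log b : ℝ) : EReal) := by
  rw [ENNReal.log_ofReal_of_pos (Real.rpow_pos_of_pos hb _), Real.log_rpow hb]
  norm_num

lemma coe_lt_growth_iff {A : ℕ∞} {b c : ℝ} (hb0 : 0 < b) (hb1 : b < 1) :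
    (c : EReal) < growth A b ↔ ENNReal.ofReal (b ^ (-c)) < A := by
  have hl : 0 < -Real.log b := neg_pos.2 (Real.log_neg hb0 hb1)
  rw [growth, EReal.lt_div_iff (by exact_mod_cast hl) (EReal.coe_ne_top _), ← EReal.coe_mul,
    ← log_ofReal_rpow_neg hb0, ENNReal.log_lt_log_iff]

lemma growth_lt_coe_iff {A : ℕ∞} {b c : ℝ} (hb0 : 0 < b) (hb1 : b < 1) :
    growth A b < (c : EReal) ↔ A < ENNReal.ofReal (b ^ (-c)) := by
  have hl : 0 < -Real.log b := neg_pos.2 (Real.log_neg hb0 hb1)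
  rw [growth, EReal.div_lt_iff (by exact_mod_cast hl) (EReal.coe_ne_top _), ← EReal.coe_mul,
    ← log_ofReal_rpow_neg hb0, ENNReal.log_lt_log_iff]

section Packing

variable {E : Type*} [MetricSpace E]

lemma exists_finset_card_eq_of_le_packingNumber {A : Set E} {ε : ℝ≥0} {n : ℕ}
    (hn : (n : ℕ∞) ≤ Metric.packingNumber ε A) :
    ∃ t : Finset E, (t : Set E) ⊆ A ∧ Metric.IsSeparated ε (t : Set E) ∧ t.card = n := by
  obtain ⟨C, hCA, hC, hcard⟩ : ∃ C ⊆ A, Metric.IsSeparated ε C ∧ (n : ℕ∞) ≤ C.encard := by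
    cases n with
    | zero => exact ⟨∅, empty_subset _, Metric.IsSeparated.empty, by simp⟩
    | succ k =>
      -- The supremum need not be attained, but a strict bound by `k` yields a separated set with at
      -- least `k + 1` points.
      have : (k : ℕ∞) < Metric.packingNumber ε A :=
        lt_of_lt_of_le (by exact_mod_cast k.lt_succ_self) hn
      simp only [Metric.packingNumber, lt_iSup_iff] at this
      obtain ⟨C, h1, h2, h3⟩ := this
      exact ⟨C, h1, h2, by push_cast; exact Order.add_one_le_of_lt h3⟩
  obtain ⟨t, htC, ht⟩ := exists_subset_encard_eq hcard
  have hfin : t.Finite := finite_of_encard_eq_coe ht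
  refine ⟨hfin.toFinset, by simpa using htC.trans hCA, by simpa using hC.subset htC, ?_⟩
  rw [hfin.encard_eq_coe_toFinset_card] at ht
  exact_mod_cast ht

lemma le_packingPreDelta_of_isSeparated {A : Set E} {s : ℝ≥0} {b δ : ℝ} (hb : 0 < b) (hbδ : b ≤ δ)
    {t : Finset E} (htA : (t : Set E) ⊆ A)
    (hsep : Metric.IsSeparated b.toNNReal (t : Set E)) :
    t.card * ENNReal.ofReal b ^ (s : ℝ) ≤ packingPreDelta s δ A := by
  classical
  -- Balls of radius `b / 2` contribute `b ^ s` each, and strict `b`-separation of the centres keeps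
  -- the closed balls disjoint.
  have hinj : Function.Injective fun x : E => (x, b / 2) := fun x y h => (Prod.mk.inj h).1
  refine le_iSup_of_le (t.map ⟨_, hinj⟩) (le_iSup₂_of_le ?_ ?_ ?_)
  · intro p hp
    obtain ⟨x, hx, rfl⟩ := Finset.mem_map.1 hp
    exact ⟨htA hx, half_pos hb, by simp only [Function.Embedding.coeFn_mk]; linarith⟩
  · intro p hp q hq hpq
    obtain ⟨x, hx, rfl⟩ := Finset.mem_map.1 (Finset.mem_coe.1 hp)
    obtain ⟨y, hy, rfl⟩ := Finset.mem_map.1 (Finset.mem_coe.1 hq)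
    have hxy : x ≠ y := fun h => hpq (by rw [h])
    have : (b.toNNReal : ℝ≥0∞) < edist x y := hsep hx hy hxy
    refine Metric.closedBall_disjoint_closedBall ?_
    simp only [Function.Embedding.coeFn_mk, add_halves]
    rw [edist_dist] at this
    exact (ENNReal.ofReal_lt_ofReal_iff_of_nonneg hb.le).1 this
  · rw [Finset.sum_map]
    simp [mul_div_cancel₀]

/-- For `s < s' < upperBoxDim A` there are, at arbitrarily small `b`, at least `b ^ (-s')` points
that are `b`-separated. Their balls contribute at least `b ^ (-(s' - s))`, which is unbounded. -/
lemma packingPremeasure_eq_top {A : Set E} {s : ℝ≥0} (h : ((s : ℝ) : EReal) < upperBoxDim A) :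
    packingPremeasure s A = ⊤ := by
  obtain ⟨s', hs1, hs2⟩ := EReal.lt_iff_exists_real_btwn.1 h
  have hs1' : 0 < s' - s := sub_pos.2 (EReal.coe_lt_coe_iff.1 hs1)
  rw [upperBoxDim_eq] at hs2
  have hf := frequently_lt_of_lt_limsup (by isBoundedDefault) hs2
  simp only [packingPremeasure, iInf_eq_top]
  intro δ hδ
  refine ENNReal.eq_top_of_forall_nnreal_le fun M => ?_
  have hlim := (tendsto_rpow_neg_nhdsGT_zero (neg_lt_zero.2 hs1')).eventually_ge_atTop (M : ℝ)
  have hsmall : ∀ᶠ b : ℝ in 𝓝[>] 0, b ∈ Ioo 0 (min δ 1) :=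
    Ioo_mem_nhdsGT (lt_min hδ one_pos)
  obtain ⟨b, hb, hM, hb0, hb1⟩ := (hf.and_eventually (hlim.and hsmall)).exists
  have hbδ : b < δ := hb1.trans_le (min_le_left _ _)
  have hb1 : b < 1 := hb1.trans_le (min_le_right _ _)
  rw [coe_lt_growth_iff hb0 hb1] at hb
  obtain ⟨n, hn, hnb⟩ : ∃ n : ℕ, (n : ℕ∞) ≤ boxCount A b ∧ ENNReal.ofReal (b ^ (-s')) ≤ n := by
    by_cases htop : boxCount A b = ⊤
    · obtain ⟨n, hn⟩ :=
        ENNReal.exists_nat_gt (r := ENNReal.ofReal (b ^ (-s'))) ENNReal.ofReal_ne_top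
      exact ⟨n, by simp [htop], hn.le⟩
    · obtain ⟨n, hn⟩ := ENat.ne_top_iff_exists.1 htop
      exact ⟨n, hn.le, by rw [← hn] at hb; simpa using hb.le⟩
  obtain ⟨t, htA, hsep, rfl⟩ := exists_finset_card_eq_of_le_packingNumber
    (hn.trans ((Metric.externalCoveringNumber_le_coveringNumber _ _).trans
      (Metric.coveringNumber_le_packingNumber _ _)))
  refine le_trans ?_ (le_packingPreDelta_of_isSeparated hb0 hbδ.le htA hsep)
  calc (M : ℝ≥0∞) ≤ ENNReal.ofReal (b ^ (-(s' - s))) := by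
        rw [← ENNReal.ofReal_coe_nnreal]
        exact ENNReal.ofReal_le_ofReal hM
    _ = ENNReal.ofReal (b ^ (-s')) * ENNReal.ofReal b ^ (s : ℝ) := by
        rw [ENNReal.ofReal_rpow_of_pos hb0, ← ENNReal.ofReal_mul (by positivity),
          ← Real.rpow_add hb0]
        congr 2
        ring
    _ ≤ _ := by gcongr

lemma packingPremeasure_empty (s : ℝ≥0) : packingPremeasure s (∅ : Set E) = 0 := by
  refine le_antisymm (iInf₂_le_of_le 1 one_pos ?_) zero_le
  refine iSup_le fun t => iSup₂_le fun ht _ => ?_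
  have : t = ∅ := Finset.eq_empty_of_forall_notMem fun p hp => (ht p hp).1
  simp [this]

lemma packingMeasure_le_packingPremeasure (s : ℝ≥0) (F : Set E) :
    packingMeasure s F ≤ packingPremeasure s F := by
  refine iInf₂_le_of_le (fun i => if i = 0 then F else ∅) (fun x hx => mem_iUnion.2 ⟨0, hx⟩) ?_
  rw [tsum_eq_single 0 fun i hi => by simp [hi, packingPremeasure_empty]]
  simp

/-- In a general metric space, disjoint balls only guarantee that the distance of the centres
exceeds a radius, not the sum of the radii. Radii above `2 * ε` thus give `2 * ε`-separated centres,
no two of which share a covering ball of radius `ε`. -/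
lemma card_le_boxCount_of_pairwiseDisjoint {F : Set E} {ε : ℝ} (hε : 0 < ε) {t : Finset (E × ℝ)}
    (hF : ∀ p ∈ t, p.1 ∈ F) (hr : ∀ p ∈ t, 2 * ε < p.2)
    (ht : (t : Set (E × ℝ)).PairwiseDisjoint (fun p => Metric.closedBall p.1 p.2)) :
    (t.card : ℕ∞) ≤ boxCount F ε := by
  have hdist : ∀ p ∈ t, ∀ q ∈ t, p ≠ q → 2 * ε < dist p.1 q.1 := by
    intro p hp q hq hpq
    by_contra! hle
    have h1 : q.1 ∈ Metric.closedBall p.1 p.2 := by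
      rw [Metric.mem_closedBall, dist_comm]
      exact hle.trans (hr p hp).le
    have h2 : q.1 ∈ Metric.closedBall q.1 q.2 :=
      Metric.mem_closedBall_self (by linarith [hr q hq])
    exact Set.disjoint_left.1 (ht hp hq hpq) h1 h2
  have hinj : InjOn Prod.fst (t : Set (E × ℝ)) := by
    intro p hp q hq h
    by_contra hpq
    have := hdist p hp q hq hpq
    rw [h, dist_self] at this
    linarith
  rw [← encard_coe_eq_coe_finsetCard, ← hinj.encard_image]
  refine le_trans (Metric.IsSeparated.encard_le_packingNumber (ε := 2 * ε.toNNReal) ?_ ?_)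
    (Metric.packingNumber_two_mul_le_externalCoveringNumber ε.toNNReal F)
  · rintro _ ⟨p, hp, rfl⟩
    exact hF p hp
  · rintro _ ⟨p, hp, rfl⟩ _ ⟨q, hq, rfl⟩ hne
    have := hdist p hp q hq fun h => hne (by rw [h])
    change ((2 * ε.toNNReal : ℝ≥0) : ℝ≥0∞) < edist p.1 q.1
    rw [edist_dist, ENNReal.coe_mul, ENNReal.coe_ofNat, ← ENNReal.ofReal.eq_1,
      ← ENNReal.ofReal_ofNat 2, ← ENNReal.ofReal_mul zero_le_two]
    exact (ENNReal.ofReal_lt_ofReal_iff_of_nonneg (by positivity)).2 this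

/-- The balls of a packing are sorted by dyadic size. A class at size `y` has at most `y ^ (-c)`
members, so it contributes at most `8 ^ s * y ^ (s - c)`, a geometric series because `c < s`. -/
lemma packingPreDelta_ne_top {F : Set E} {s : ℝ≥0} {c δ : ℝ} (hcs : c < s) (hδ1 : δ ≤ 1)
    (h : ∀ b : ℝ, 0 < b → b < δ → (boxCount F b : ℝ≥0∞) ≤ ENNReal.ofReal (b ^ (-c))) :
    packingPreDelta s δ F ≠ ⊤ := by
  classical
  -- Radii between `2 ^ (-(k+1))` and `2 ^ (-k)` exceed `2 * y k`, as the separation bound requires,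
  -- and have diameters at most `8 * y k`.
  set y : ℕ → ℝ := fun k => (1 / 2) ^ (k + 2) with hy
  have hy0 : ∀ k, 0 < y k := fun k => by positivity
  have hsum : Summable fun k => (8 : ℝ) ^ (s : ℝ) * y k ^ ((s : ℝ) - c) := by
    refine Summable.mul_left _ ?_
    have e : ∀ k, y k ^ ((s : ℝ) - c) = ((1 / 2 : ℝ) ^ ((s : ℝ) - c)) ^ (k + 2) := fun k =>
      (Real.rpow_pow_comm (by norm_num) _ _).symm
    simp_rw [e]
    exact (summable_nat_add_iff 2).2 (summable_geometric_of_lt_one (by positivity)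
      (Real.rpow_lt_one (by norm_num) (by norm_num) (sub_pos.2 hcs)))
  refine ne_top_of_le_ne_top hsum.tsum_ofReal_ne_top ?_
  refine iSup_le fun t => iSup₂_le fun ht hdisj => ?_
  have hk : ∀ p : E × ℝ, ∃ k : ℕ, p ∈ t → (1 / 2 : ℝ) ^ (k + 1) < p.2 ∧ p.2 ≤ (1 / 2) ^ k := by
    intro p
    by_cases hp : p ∈ t
    · obtain ⟨k, hk⟩ := exists_nat_pow_near_of_lt_one (ht p hp).2.1 ((ht p hp).2.2.trans hδ1)
        (by norm_num : (0 : ℝ) < 1 / 2) (by norm_num)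
      exact ⟨k, fun _ => hk⟩
    · exact ⟨0, fun h => absurd h hp⟩
  choose k hk using hk
  rw [← Finset.sum_fiberwise_of_maps_to (t := t.image k) fun p hp => Finset.mem_image_of_mem k hp]
  refine le_trans (Finset.sum_le_sum fun i hi => ?_) (ENNReal.sum_le_tsum (t.image k))
  set ti := t.filter fun p => k p = i with hti
  have hmem : ∀ p ∈ ti, p ∈ t ∧ 2 * y i < p.2 ∧ 2 * p.2 ≤ 8 * y i := by
    intro p hp
    obtain ⟨hpt, hpi⟩ := Finset.mem_filter.1 hp
    have h1 := hk p hpt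
    rw [hpi] at h1
    refine ⟨hpt, ?_, ?_⟩
    · convert h1.1 using 1
      simp only [hy]; ring
    · refine (mul_le_mul_of_nonneg_left h1.2 zero_le_two).trans_eq ?_
      simp only [hy]; ring
  have hyδ : y i < δ := by
    obtain ⟨p, hp, hpi⟩ := Finset.mem_image.1 hi
    have := hmem p (Finset.mem_filter.2 ⟨hp, hpi⟩)
    linarith [(ht p hp).2.2, hy0 i]
  have hcard : (ti.card : ℝ≥0∞) ≤ ENNReal.ofReal (y i ^ (-c)) := by
    refine le_trans ?_ (h (y i) (hy0 i) hyδ)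
    have := card_le_boxCount_of_pairwiseDisjoint (hy0 i) (fun p hp => (ht p (hmem p hp).1).1)
      (fun p hp => (hmem p hp).2.1) (hdisj.subset fun p hp => (hmem p hp).1)
    exact_mod_cast this
  calc ∑ p ∈ ti, ENNReal.ofReal (2 * p.2) ^ (s : ℝ)
      ≤ ∑ _p ∈ ti, ENNReal.ofReal (8 * y i) ^ (s : ℝ) := by
        refine Finset.sum_le_sum fun p hp => ?_
        exact ENNReal.rpow_le_rpow (ENNReal.ofReal_le_ofReal (hmem p hp).2.2) s.2
    _ = ti.card * ENNReal.ofReal (8 * y i) ^ (s : ℝ) := by simp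
    _ ≤ ENNReal.ofReal (y i ^ (-c)) * ENNReal.ofReal (8 * y i) ^ (s : ℝ) := by gcongr
    _ = ENNReal.ofReal (8 ^ (s : ℝ) * y i ^ ((s : ℝ) - c)) := by
        have := hy0 i
        rw [ENNReal.ofReal_rpow_of_pos (by positivity), ← ENNReal.ofReal_mul (by positivity),
          Real.mul_rpow (by norm_num) this.le, sub_eq_add_neg, Real.rpow_add this]
        congr 1
        ring

lemma packingMeasure_ne_top {F : Set E} {s : ℝ≥0} (h : upperBoxDim F < ((s : ℝ) : EReal)) :
    packingMeasure s F ≠ ⊤ := by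
  obtain ⟨c, hc1, hc2⟩ := EReal.lt_iff_exists_real_btwn.1 h
  rw [upperBoxDim_eq] at hc1
  have hev := eventually_lt_of_limsup_lt hc1
  obtain ⟨δ, hδ, hsub⟩ := mem_nhdsGT_iff_exists_Ioo_subset.1 hev
  have hδ' : 0 < min δ 1 := lt_min hδ one_pos
  refine ne_top_of_le_ne_top (packingPreDelta_ne_top (F := F) (δ := min δ 1)
    (EReal.coe_lt_coe_iff.1 hc2) (min_le_right _ _) fun b hb0 hb1 => ?_)
    ((packingMeasure_le_packingPremeasure s F).trans (iInf₂_le _ hδ'))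
  have := hsub ⟨hb0, hb1.trans_le (min_le_left _ _)⟩
  exact ((growth_lt_coe_iff hb0 (hb1.trans_le (min_le_right _ _))).1 this).le

lemma upperBoxDim_nonneg {F : Set E} (hF : F.Nonempty) : 0 ≤ upperBoxDim F := by
  rw [upperBoxDim_eq]
  refine le_limsup_of_frequently_le (Eventually.frequently ?_) (by isBoundedDefault)
  filter_upwards [Ioo_mem_nhdsGT (one_pos : (0 : ℝ) < 1)] with b hb
  refine EReal.div_nonneg (ENNReal.zero_le_log_iff.2 ?_)
    (by exact_mod_cast neg_nonneg.2 (Real.log_neg hb.1 hb.2).le)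
  exact_mod_cast Order.one_le_iff_ne_zero.2 (boxCount_ne_zero hF b)

lemma packingDim_le_upperBoxDim {F : Set E} (hF : F.Nonempty) :
    (packingDim F : EReal) ≤ upperBoxDim F := by
  rw [← EReal.coe_toENNReal (upperBoxDim_nonneg hF), EReal.coe_ennreal_le_coe_ennreal_iff]
  refine iSup₂_le fun s hs => ?_
  by_contra! hlt
  refine packingMeasure_ne_top (F := F) (s := s) ?_ hs
  rw [← EReal.coe_toENNReal (upperBoxDim_nonneg hF), ← EReal.coe_nnreal_eq_coe_real,
    EReal.coe_ennreal_lt_coe_ennreal_iff]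
  exact hlt

lemma upperBoxDim_le_packingDim {F : Set E} (hF : F.Nonempty)
    (h : ∀ s : ℝ≥0, ((s : ℝ) : EReal) < upperBoxDim F → packingMeasure s F = ⊤) :
    upperBoxDim F ≤ (packingDim F : EReal) := by
  rw [← EReal.coe_toENNReal (upperBoxDim_nonneg hF), EReal.coe_ennreal_le_coe_ennreal_iff]
  refine ENNReal.le_of_forall_nnreal_lt fun s hs => le_iSup₂_of_le s (h s ?_) le_rfl
  rw [← EReal.coe_toENNReal (upperBoxDim_nonneg hF), ← EReal.coe_nnreal_eq_coe_real,
    EReal.coe_ennreal_lt_coe_ennreal_iff]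
  exact hs

lemma upperBoxDim_mono {A F : Set E} (h : A ⊆ F) : upperBoxDim A ≤ upperBoxDim F := by
  rw [upperBoxDim_eq, upperBoxDim_eq]
  refine limsup_le_limsup ?_
  filter_upwards [Ioo_mem_nhdsGT (one_pos : (0 : ℝ) < 1)] with b hb
  exact growth_mono_left (boxCount_mono h b) hb.1 hb.2

/-- A finite union of closed balls is closed, so it covers the closure too; without a finite cover
the bound is `⊤`. -/
lemma boxCount_closure (F : Set E) {δ : ℝ} (hδ : 0 ≤ δ) :
    boxCount (closure F) δ = boxCount F δ := by
  refine le_antisymm ?_ (boxCount_mono subset_closure δ)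
  obtain ⟨C, hC, hcard⟩ := exists_boxCount_eq_encard (F := F) hδ
  rw [← hcard]
  by_cases hfin : C.Finite
  · exact boxCount_le_encard
      (closure_minimal hC (hfin.isClosed_biUnion fun _ _ => Metric.isClosed_closedBall))
  · simp [Set.Infinite.encard_eq hfin]

lemma upperBoxDim_closure (F : Set E) : upperBoxDim (closure F) = upperBoxDim F := by
  rw [upperBoxDim_eq, upperBoxDim_eq]
  refine limsup_congr ?_
  filter_upwards [self_mem_nhdsWithin] with b hb
  rw [boxCount_closure F (le_of_lt hb)]

/-- A set that no countable family of closed sets of smaller upper box dimension can cover has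
packing dimension at least its upper box dimension. -/
lemma upperBoxDim_le_packingDim_of_cover {F : Set E} (hF : F.Nonempty)
    (h : ∀ t : ℕ → Set E, (∀ i, IsClosed (t i)) → F ⊆ ⋃ i, t i →
      ∃ i, upperBoxDim F ≤ upperBoxDim (t i)) :
    upperBoxDim F ≤ (packingDim F : EReal) := by
  refine upperBoxDim_le_packingDim hF fun s hs => ?_
  simp only [packingMeasure, iInf_eq_top]
  intro t ht
  obtain ⟨i, hi⟩ := h (fun i => closure (t i)) (fun i => isClosed_closure)
    (ht.trans (iUnion_mono fun i => subset_closure))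
  rw [upperBoxDim_closure] at hi
  exact ENNReal.tsum_eq_top_of_eq_top ⟨i, packingPremeasure_eq_top (hs.trans_le hi)⟩

end Packing

/-! ### Words and coding of the attractors -/

namespace MoranWord

variable {N : ℕ → ℕ}

lemma take_congr {σ τ : ∀ i, Fin (N i)} :
    ∀ {n k : ℕ}, (∀ i, n ≤ i → i < n + k → σ i = τ i) → take σ n k = take τ n k
  | _, 0, _ => rfl
  | n, k + 1, h => by
    rw [take, take, h n le_rfl (by omega), take_congr fun i h1 h2 => h i (by omega) (by omega)]

/-- Viewing words as prefixes of sequences turns weights into products over `Finset.range` and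
`dropLast` into a shorter prefix. -/
lemma exists_take_eq (hN : ∀ n, 0 < N n) :
    ∀ {n k : ℕ} (J : MoranWord N n k), ∃ σ : ∀ i, Fin (N i), take σ n k = J
  | _, _, nil => ⟨fun i => ⟨0, hN i⟩, rfl⟩
  | n, _, cons j J => by
    obtain ⟨σ, rfl⟩ := exists_take_eq hN J
    refine ⟨Function.update σ n j, ?_⟩
    rw [take, Function.update_self]
    congr 1
    exact take_congr fun i h1 _ => Function.update_of_ne (by omega) _ _

lemma dropLast_take (σ : ∀ i, Fin (N i)) :
    ∀ n k : ℕ, (take σ n (k + 1)).dropLast = take σ n k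
  | _, 0 => rfl
  | n, k + 1 => congrArg (cons (σ n)) (dropLast_take σ (n + 1) k)

/-- The product of the weights of the letters of a word. -/
def weight (r : (n : ℕ) → Fin (N n) → ℝ) : {n k : ℕ} → MoranWord N n k → ℝ
  | _, _, nil => 1
  | n, _, cons j J => r n j * weight r J

lemma weight_take (r : (n : ℕ) → Fin (N n) → ℝ) (σ : ∀ i, Fin (N i)) :
    ∀ n k : ℕ, weight r (take σ n k) = ∏ i ∈ Finset.range k, r (n + i) (σ (n + i))
  | _, 0 => by simp [take, weight]
  | n, k + 1 => by
    rw [take, weight, weight_take r σ (n + 1) k, Finset.prod_range_succ', mul_comm]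
    congr 1
    refine Finset.prod_congr rfl fun i _ => ?_
    rw [show n + 1 + i = n + (i + 1) by ring]

lemma weight_pos {r : (n : ℕ) → Fin (N n) → ℝ} (hr : ∀ n j, 0 < r n j) :
    ∀ {n k : ℕ} (J : MoranWord N n k), 0 < weight r J
  | _, _, nil => one_pos
  | n, _, cons j J => mul_pos (hr n j) (weight_pos hr J)

end MoranWord

namespace MIFS

variable {d : ℕ} {X : Set (EuclideanSpace ℝ (Fin d))} (S : MIFS X)

lemma N_pos (n : ℕ) : 0 < S.N n := two_pos.trans_le (S.two_le_N n)

/-- `P n k` is the product of the upper Lipschitz bounds of the layers `n, …, n + k - 1`. It tends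
to zero, being the full product divided by its first `n` factors, which are fixed and nonzero. -/
lemma exists_wordMap_contraction : ∃ P : ℕ → ℕ → ℝ, (∀ n k, 0 ≤ P n k) ∧
    (∀ n, Tendsto (P n) atTop (𝓝 0)) ∧
    ∀ (n k : ℕ) (J : MoranWord S.N n k) (x y : X),
      dist (S.wordMap J x) (S.wordMap J y) ≤ P n k * dist x y := by
  obtain ⟨c₁, c₂, hc, hlim, hbi⟩ := S.bilipschitz
  have hpos : ∀ n, 0 < c₂ n := fun n => (hc n).1.trans_le (hc n).2.1
  refine ⟨fun n k => ∏ i ∈ Finset.range k, c₂ (n + i),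
    fun n k => Finset.prod_nonneg fun i _ => (hpos _).le, fun n => ?_, ?_⟩
  · have h1 : Tendsto (fun k => ∏ i ∈ Finset.range (n + k), c₂ i) atTop (𝓝 0) := by
      simpa [add_comm n, Function.comp_def] using hlim.comp (tendsto_add_atTop_nat n)
    have h2 := h1.const_mul (∏ i ∈ Finset.range n, c₂ i)⁻¹
    rw [mul_zero] at h2
    refine h2.congr fun k => ?_
    rw [Finset.prod_range_add, inv_mul_cancel_left₀]
    exact Finset.prod_ne_zero_iff.2 fun i _ => (hpos i).ne'
  · intro n k J x y
    induction J with
    | nil => simp [wordMap]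
    | @cons n k j J ih =>
      refine ((hbi n j _ _).2).trans ?_
      refine (mul_le_mul_of_nonneg_left ih (hpos n).le).trans_eq ?_
      dsimp only
      rw [Finset.prod_range_succ', ← mul_assoc, mul_comm (c₂ n)]
      congr 2
      refine Finset.prod_congr rfl fun i _ => ?_
      rw [show n + 1 + i = n + (i + 1) by ring]

lemma continuous_wordMap {n k : ℕ} (J : MoranWord S.N n k) : Continuous (S.wordMap J) := by
  obtain ⟨P, -, -, h⟩ := S.exists_wordMap_contraction
  exact (LipschitzWith.of_dist_le' (h n k J)).continuous

/-- The map of the word of length `k` from the layer `n` on along a sequence of letters. -/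
def iter (σ : ∀ i, Fin (S.N i)) (n k : ℕ) : X → X :=
  S.wordMap (MoranWord.take σ n k)

lemma iter_add (σ : ∀ i, Fin (S.N i)) (n k l : ℕ) (x : X) :
    S.iter σ n (k + l) x = S.iter σ n k (S.iter σ (n + k) l x) := by
  induction k generalizing n with
  | zero =>
    rw [Nat.zero_add]
    rfl
  | succ k ih =>
    have h := ih (n + 1)
    rw [show n + 1 + k = n + (k + 1) by ring] at h
    rw [show k + 1 + l = k + l + 1 by ring]
    exact congrArg (S.map n (σ n)) h

lemma iter_congr {σ τ : ∀ i, Fin (S.N i)} {n k : ℕ} (h : ∀ i, n ≤ i → i < n + k → σ i = τ i) :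
    S.iter σ n k = S.iter τ n k := by
  rw [iter, iter, MoranWord.take_congr h]

/-- From index `k` on, all iterates lie in the image of one word map, whose diameter is at most `P n
k * diam X`. -/
lemma exists_tendsto_iter [Nonempty X] (σ : ∀ i, Fin (S.N i)) (n : ℕ) :
    ∃ x : X, ∀ a : X, Tendsto (fun k => S.iter σ n k a) atTop (𝓝 x) := by
  obtain ⟨P, hP0, hP, hdist⟩ := S.exists_wordMap_contraction
  have : CompactSpace X := isCompact_iff_compactSpace.1 S.isCompact
  have hb : ∀ x y : X, dist x y ≤ Metric.diam (univ : Set X) := fun x y =>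
    Metric.dist_le_diam_of_mem isCompact_univ.isBounded (mem_univ x) (mem_univ y)
  have hlim : ∀ M : ℝ, Tendsto (fun k => P n k * M) atTop (𝓝 0) := fun M => by
    simpa using (hP n).mul_const M
  obtain ⟨a₀⟩ := ‹Nonempty X›
  have hcauchy : CauchySeq fun k => S.iter σ n k a₀ := by
    refine cauchySeq_of_le_tendsto_0 (fun k => P n k * Metric.diam (univ : Set X)) ?_ (hlim _)
    intro p q k hp hq
    obtain ⟨p, rfl⟩ := Nat.exists_eq_add_of_le hp
    obtain ⟨q, rfl⟩ := Nat.exists_eq_add_of_le hq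
    rw [iter_add, iter_add]
    exact (hdist _ _ _ _ _).trans (mul_le_mul_of_nonneg_left (hb _ _) (hP0 n k))
  obtain ⟨x, hx⟩ := cauchySeq_tendsto_of_complete hcauchy
  refine ⟨x, fun a => hx.congr_dist ?_⟩
  exact squeeze_zero (fun _ => dist_nonneg) (fun k => hdist _ _ _ _ _) (hlim (dist a₀ a))

/-- The point coded by a sequence of letters from the layer `n` on. -/
noncomputable def code [Nonempty X] (σ : ∀ i, Fin (S.N i)) (n : ℕ) : X :=
  (S.exists_tendsto_iter σ n).choose

section Code

variable [Nonempty X]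

lemma tendsto_iter (σ : ∀ i, Fin (S.N i)) (n : ℕ) (a : X) :
    Tendsto (fun k => S.iter σ n k a) atTop (𝓝 (S.code σ n)) :=
  (S.exists_tendsto_iter σ n).choose_spec a

lemma attractor_eq_range (n : ℕ) :
    S.attractor n = range fun σ => (S.code σ n : EuclideanSpace ℝ (Fin d)) := by
  have h : ∀ σ (a : X), Tendsto
      (fun k => (S.wordMap (MoranWord.take σ n k) a : EuclideanSpace ℝ (Fin d))) atTop
      (𝓝 (S.code σ n)) := fun σ a =>
    (continuous_subtype_val.tendsto _).comp (S.tendsto_iter σ n a)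
  ext x
  constructor
  · rintro ⟨σ, a, hx⟩
    exact ⟨σ, tendsto_nhds_unique (h σ a) hx⟩
  · rintro ⟨σ, rfl⟩
    exact ⟨σ, Classical.arbitrary X, h σ _⟩

lemma code_mem_attractor (σ : ∀ i, Fin (S.N i)) (n : ℕ) :
    (S.code σ n : EuclideanSpace ℝ (Fin d)) ∈ S.attractor n := by
  rw [attractor_eq_range]
  exact mem_range_self σ

lemma attractor_subset (n : ℕ) : S.attractor n ⊆ X := by
  rw [attractor_eq_range]
  rintro _ ⟨σ, rfl⟩
  exact (S.code σ n).2

lemma totallyBounded_attractor (n : ℕ) : TotallyBounded (S.attractor n) :=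
  S.isCompact.totallyBounded.subset (S.attractor_subset n)

lemma attractor_nonempty (n : ℕ) : (S.attractor n).Nonempty :=
  ⟨_, S.code_mem_attractor (fun i => ⟨0, S.N_pos i⟩) n⟩

lemma code_eq_iter (σ : ∀ i, Fin (S.N i)) (n k : ℕ) :
    S.code σ n = S.iter σ n k (S.code σ (n + k)) := by
  obtain ⟨a⟩ := ‹Nonempty X›
  have h1 := ((S.continuous_wordMap (MoranWord.take σ n k)).tendsto _).comp
    (S.tendsto_iter σ (n + k) a)
  have h2 := (S.tendsto_iter σ n a).comp (tendsto_add_atTop_nat k)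
  refine tendsto_nhds_unique h2 (h1.congr fun l => ?_)
  simp only [Function.comp_apply]
  rw [add_comm l k, iter_add]
  rfl

lemma code_congr {σ τ : ∀ i, Fin (S.N i)} {n : ℕ} (h : ∀ i, n ≤ i → σ i = τ i) :
    S.code σ n = S.code τ n := by
  obtain ⟨a⟩ := ‹Nonempty X›
  refine tendsto_nhds_unique (S.tendsto_iter σ n a) ((S.tendsto_iter τ n a).congr fun k => ?_)
  rw [S.iter_congr fun i hi _ => h i hi]

lemma continuous_code (n : ℕ) : Continuous fun σ => S.code σ n := by
  obtain ⟨P, hP0, hP, hdist⟩ := S.exists_wordMap_contraction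
  have : CompactSpace X := isCompact_iff_compactSpace.1 S.isCompact
  have hb : ∀ x y : X, dist x y ≤ Metric.diam (univ : Set X) := fun x y =>
    Metric.dist_le_diam_of_mem isCompact_univ.isBounded (mem_univ x) (mem_univ y)
  rw [continuous_iff_continuousAt]
  intro σ
  refine Metric.tendsto_nhds.2 fun ε hε => ?_
  have hlim : Tendsto (fun k => P n k * Metric.diam (univ : Set X)) atTop (𝓝 0) := by
    simpa using (hP n).mul_const (Metric.diam (univ : Set X))
  obtain ⟨k, hk⟩ := (hlim.eventually (gt_mem_nhds hε)).exists
  have hnhds : (Finset.range (n + k) : Set ℕ).pi (fun i => ({σ i} : Set (Fin (S.N i)))) ∈ 𝓝 σ :=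
    set_pi_mem_nhds (Finset.finite_toSet _) fun i _ => (isOpen_discrete _).mem_nhds rfl
  filter_upwards [hnhds] with τ hτ
  rw [S.code_eq_iter τ n k, S.code_eq_iter σ n k,
    S.iter_congr (τ := σ) fun i _ hi => hτ i (by simpa using hi)]
  exact ((hdist _ _ _ _ _).trans (mul_le_mul_of_nonneg_left (hb _ _) (hP0 n k))).trans_lt hk

/-- Baire's theorem for codes: one of countably many closed sets that cover the attractor contains
the whole image of a word. -/
lemma exists_iter_image_subset {n : ℕ} {t : ℕ → Set (EuclideanSpace ℝ (Fin d))}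
    (hclosed : ∀ i, IsClosed (t i)) (hcover : S.attractor n ⊆ ⋃ i, t i) :
    ∃ i k σ, ∀ x : X, (x : EuclideanSpace ℝ (Fin d)) ∈ S.attractor (n + k) →
      (S.iter σ n k x : EuclideanSpace ℝ (Fin d)) ∈ t i ∩ S.attractor n := by
  have : ∀ i, Nonempty (Fin (S.N i)) := fun i => ⟨⟨0, S.N_pos i⟩⟩
  obtain ⟨i, σ, hσ⟩ := nonempty_interior_of_iUnion_of_closed
    (f := fun i => (fun σ => (S.code σ n : EuclideanSpace ℝ (Fin d))) ⁻¹' t i)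
    (fun i => (hclosed i).preimage (continuous_subtype_val.comp (S.continuous_code n)))
    (by
      rw [← preimage_iUnion]
      exact eq_univ_of_forall fun σ => hcover (S.code_mem_attractor σ n))
  obtain ⟨I, hI, u, hu, hsub⟩ : ∃ I : Set ℕ, I.Finite ∧ ∃ u : ∀ i, Set (Fin (S.N i)),
      (∀ i, u i ∈ 𝓝 (σ i)) ∧
        I.pi u ⊆ (fun σ => (S.code σ n : EuclideanSpace ℝ (Fin d))) ⁻¹' t i := by
    rw [mem_interior_iff_mem_nhds, nhds_pi, Filter.mem_pi] at hσ
    exact hσ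
  obtain ⟨m, hm⟩ := hI.bddAbove
  refine ⟨i, m + 1, σ, fun x hx => ?_⟩
  rw [attractor_eq_range] at hx
  obtain ⟨τ, hτ⟩ := hx
  have hx' : x = S.code τ (n + (m + 1)) := Subtype.ext hτ.symm
  -- The splice follows `σ` past every coordinate that the basic neighbourhood constrains, all of
  -- them at most `m`, and then continues with the code `τ` of `x`.
  set μ : ∀ i, Fin (S.N i) := fun i => if i < n + (m + 1) then σ i else τ i with hμ
  have hcode : S.code μ n = S.iter σ n (m + 1) x := by
    rw [S.code_eq_iter μ n (m + 1), hx',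
      S.iter_congr (τ := σ) fun i _ hi => by simp only [hμ, if_pos hi],
      S.code_congr (τ := τ) fun i hi => by simp only [hμ, if_neg (not_lt.2 hi)]]
  rw [← hcode]
  refine ⟨hsub fun j hj => ?_, S.code_mem_attractor μ n⟩
  have : j < n + (m + 1) := by have := hm hj; omega
  simp only [hμ, if_pos this]
  exact mem_of_mem_nhds (hu j)

end Code

/-! ### Self-similar systems -/

/-- The map `φ_{n,j}` is a similarity of ratio `r n j` less than one. -/
structure IsSelfSimilar (r : (n : ℕ) → Fin (S.N n) → ℝ) : Prop where
  mem_Ioo : ∀ n j, r n j ∈ Ioo (0 : ℝ) 1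
  exists_extension : ∀ n j, ∃ (L : EuclideanSpace ℝ (Fin d) ≃ₗᵢ[ℝ] EuclideanSpace ℝ (Fin d))
    (c : EuclideanSpace ℝ (Fin d)), ∀ x : X,
      (S.map n j x : EuclideanSpace ℝ (Fin d)) = r n j • L x + c

end MIFS

lemma isSimilarity_smul_isometry_add {d : ℕ} {ρ : ℝ} (hρ : 0 < ρ)
    (L : EuclideanSpace ℝ (Fin d) ≃ₗᵢ[ℝ] EuclideanSpace ℝ (Fin d))
    (c : EuclideanSpace ℝ (Fin d)) : IsSimilarity ρ fun x => ρ • L x + c := by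
  refine ⟨hρ, fun x y => ?_, fun y => ⟨L.symm (ρ⁻¹ • (y - c)), ?_⟩⟩
  · rw [dist_add_right, dist_smul₀, L.dist_map, Real.norm_of_nonneg hρ.le]
  · simp [smul_smul, hρ.ne']

namespace MIFS

variable {d : ℕ} {X : Set (EuclideanSpace ℝ (Fin d))} {S : MIFS X}
  {r : (n : ℕ) → Fin (S.N n) → ℝ}

namespace IsSelfSimilar

lemma weight_pos (hS : S.IsSelfSimilar r) {n k : ℕ} (J : MoranWord S.N n k) :
    0 < J.weight r := MoranWord.weight_pos (fun n j => (hS.mem_Ioo n j).1) J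

lemma wordMap_extension (hS : S.IsSelfSimilar r) {n k : ℕ} (J : MoranWord S.N n k) :
    ∃ (L : EuclideanSpace ℝ (Fin d) ≃ₗᵢ[ℝ] EuclideanSpace ℝ (Fin d))
    (c : EuclideanSpace ℝ (Fin d)), ∀ x : X,
      (S.wordMap J x : EuclideanSpace ℝ (Fin d)) = J.weight r • L x + c := by
  induction J with
  | nil => exact ⟨LinearIsometryEquiv.refl ℝ _, 0, fun x => by simp [wordMap, MoranWord.weight]⟩
  | @cons n k j J ih =>
    obtain ⟨L, c, h⟩ := ih
    obtain ⟨L', c', h'⟩ := hS.exists_extension n j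
    refine ⟨L.trans L', r n j • L' c + c', fun x => ?_⟩
    simp only [wordMap, MoranWord.weight, Function.comp_apply, h', h]
    simp [smul_smul, add_assoc]

lemma dist_wordMap (hS : S.IsSelfSimilar r) {n k : ℕ} (J : MoranWord S.N n k) (x y : X) :
    dist (S.wordMap J x) (S.wordMap J y) = J.weight r * dist x y := by
  obtain ⟨L, c, h⟩ := hS.wordMap_extension J
  rw [Subtype.dist_eq, h, h]
  exact (isSimilarity_smul_isometry_add (hS.weight_pos J) L c).dist_eq _ _

lemma ratio_eq [Nontrivial X] (hS : S.IsSelfSimilar r) {n k : ℕ} (J : MoranWord S.N n k) :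
    S.ratio J = J.weight r := by
  have : {q | ∃ x y : X, x ≠ y ∧ q = dist (S.wordMap J x) (S.wordMap J y) / dist x y} =
      {J.weight r} := by
    ext q
    constructor
    · rintro ⟨x, y, hxy, rfl⟩
      rw [hS.dist_wordMap, mul_div_cancel_right₀ _ (dist_ne_zero.2 hxy)]
      rfl
    · rintro rfl
      obtain ⟨x, y, hxy⟩ := exists_pair_ne X
      exact ⟨x, y, hxy, by rw [hS.dist_wordMap, mul_div_cancel_right₀ _ (dist_ne_zero.2 hxy)]⟩
  rw [ratio, this, csSup_singleton]

/-- Word maps scale distances exactly by their weight, so one pair of distinct points bounds the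
weight by the Lipschitz constant `P n k`. -/
lemma tendsto_weight_take [Nontrivial X] (hS : S.IsSelfSimilar r) (σ : ∀ i, Fin (S.N i)) (n : ℕ) :
    Tendsto (fun k => (MoranWord.take σ n k).weight r) atTop (𝓝 0) := by
  obtain ⟨P, hP0, hP, hdist⟩ := S.exists_wordMap_contraction
  refine squeeze_zero (fun k => (hS.weight_pos _).le) (fun k => ?_) (hP n)
  obtain ⟨x, y, hxy⟩ := exists_pair_ne X
  have := hdist n k (MoranWord.take σ n k) x y
  rw [hS.dist_wordMap] at this
  exact le_of_mul_le_mul_right this (dist_pos.2 hxy)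

lemma take_mem_cutWords_iff [Nontrivial X] (hS : S.IsSelfSimilar r) (σ : ∀ i, Fin (S.N i))
    (k : ℕ) (b : ℝ) : ⟨k, MoranWord.take σ 0 (k + 1)⟩ ∈ S.cutWords b ↔
      (MoranWord.take σ 0 (k + 1)).weight r ≤ b ∧ b < (MoranWord.take σ 0 k).weight r := by
  simp only [cutWords, mem_ofPred_eq, hS.ratio_eq, MoranWord.dropLast_take]

lemma exists_take_mem_cutWords [Nontrivial X] (hS : S.IsSelfSimilar r) (σ : ∀ i, Fin (S.N i))
    {b : ℝ} (hb0 : 0 < b) (hb1 : b < 1) : ∃ k, ⟨k, MoranWord.take σ 0 (k + 1)⟩ ∈ S.cutWords b := by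
  classical
  have hex : ∃ k, (MoranWord.take σ 0 k).weight r ≤ b :=
    ((hS.tendsto_weight_take σ 0).eventually (ge_mem_nhds hb0)).exists
  -- The empty word has weight `1 > b`, so the first prefix of weight at most `b` is nonempty.
  have h0 : Nat.find hex ≠ 0 := by
    intro h
    have := Nat.find_spec hex
    rw [h] at this
    simp only [MoranWord.take, MoranWord.weight] at this
    linarith
  obtain ⟨k, hk⟩ := Nat.exists_eq_succ_of_ne_zero h0
  refine ⟨k, (hS.take_mem_cutWords_iff σ k b).2 ⟨?_, not_le.1 (Nat.find_min hex (by omega))⟩⟩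
  have := Nat.find_spec hex
  rwa [hk] at this

/-! ### Dimensions of the attractors of the different layers -/

lemma upperBoxDim_le_of_iter [Nonempty X] (hS : S.IsSelfSimilar r) {n k : ℕ}
    {σ : ∀ i, Fin (S.N i)} {F : Set (EuclideanSpace ℝ (Fin d))} (hF : TotallyBounded F)
    (h : ∀ x : X, (x : EuclideanSpace ℝ (Fin d)) ∈ S.attractor (n + k) →
      (S.iter σ n k x : EuclideanSpace ℝ (Fin d)) ∈ F) :
    upperBoxDim (S.attractor (n + k)) ≤ upperBoxDim F := by
  obtain ⟨L, c, hL⟩ := hS.wordMap_extension (MoranWord.take σ n k)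
  have hG := isSimilarity_smul_isometry_add (hS.weight_pos (MoranWord.take σ n k)) L c
  refine hG.upperBoxDim_le ?_
    (S.attractor_nonempty _) hF
  rintro _ ⟨x, hx, rfl⟩
  have := h ⟨x, S.attractor_subset _ hx⟩ hx
  rw [iter, hL] at this
  exact this

lemma attractor_eq_iUnion_image [Nonempty X] {n : ℕ}
    {G : Fin (S.N n) → EuclideanSpace ℝ (Fin d) → EuclideanSpace ℝ (Fin d)}
    (hG : ∀ j (x : X), (S.map n j x : EuclideanSpace ℝ (Fin d)) = G j x) :
    S.attractor n = ⋃ j, G j '' S.attractor (n + 1) := by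
  have hstep : ∀ σ, (S.code σ n : EuclideanSpace ℝ (Fin d)) = G (σ n) (S.code σ (n + 1)) :=
    fun σ => by
      rw [S.code_eq_iter σ n 1, ← hG]
      rfl
  ext x
  simp only [mem_iUnion, attractor_eq_range]
  constructor
  · rintro ⟨σ, rfl⟩
    exact ⟨σ n, _, ⟨σ, rfl⟩, (hstep σ).symm⟩
  · rintro ⟨j, _, ⟨σ, rfl⟩, rfl⟩
    refine ⟨Function.update σ n j, ?_⟩
    simp only [hstep, Function.update_self]
    rw [S.code_congr (τ := σ) fun i hi => Function.update_of_ne (by omega) _ _]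

/-- One similar copy inside `K_n` gives one inequality, the finite union of copies the other. The
lower dimension is not finitely stable in general, but here all pieces are copies of one set and are
counted at the same scale. -/
lemma boxDim_attractor_succ [Nonempty X] (hS : S.IsSelfSimilar r) (n : ℕ) :
    lowerBoxDim (S.attractor (n + 1)) = lowerBoxDim (S.attractor n) ∧
      upperBoxDim (S.attractor (n + 1)) = upperBoxDim (S.attractor n) := by
  choose L c hL using hS.exists_extension n
  have hG : ∀ j, IsSimilarity (r n j) fun x => r n j • L j x + c j := fun j =>
    isSimilarity_smul_isometry_add (hS.mem_Ioo n j).1 (L j) (c j)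
  have hU := attractor_eq_iUnion_image (S := S) (n := n) (G := fun j x => r n j • L j x + c j) hL
  have hsub : (fun x => r n ⟨0, S.N_pos n⟩ • L ⟨0, S.N_pos n⟩ x + c ⟨0, S.N_pos n⟩) ''
      S.attractor (n + 1) ⊆ S.attractor n := by
    conv_rhs => rw [hU]
    exact subset_iUnion (fun j => (fun x => r n j • L j x + c j) '' S.attractor (n + 1))
      ⟨0, S.N_pos n⟩
  have hdom := growthDominated_boxCount_iUnion_image hG (fun j => (hS.mem_Ioo n j).2.le) hU
    (S.attractor_nonempty n) (S.totallyBounded_attractor (n + 1))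
  refine ⟨le_antisymm ?_ ?_, le_antisymm ?_ ?_⟩
  · exact (hG _).lowerBoxDim_le hsub (S.attractor_nonempty _) (S.totallyBounded_attractor n)
  · rw [lowerBoxDim_eq, lowerBoxDim_eq]
    exact hdom.liminf_le
  · exact (hG _).upperBoxDim_le hsub (S.attractor_nonempty _) (S.totallyBounded_attractor n)
  · rw [upperBoxDim_eq, upperBoxDim_eq]
    exact hdom.limsup_le

lemma lowerBoxDim_attractor [Nonempty X] (hS : S.IsSelfSimilar r) (n : ℕ) :
    lowerBoxDim (S.attractor n) = lowerBoxDim (S.attractor 0) := by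
  induction n with
  | zero => rfl
  | succ n ih => rw [(hS.boxDim_attractor_succ n).1, ih]

lemma upperBoxDim_attractor [Nonempty X] (hS : S.IsSelfSimilar r) (n : ℕ) :
    upperBoxDim (S.attractor n) = upperBoxDim (S.attractor 0) := by
  induction n with
  | zero => rfl
  | succ n ih => rw [(hS.boxDim_attractor_succ n).2, ih]

lemma upperBoxDim_attractor_eq_packingDim [Nonempty X] (hS : S.IsSelfSimilar r) (n : ℕ) :
    upperBoxDim (S.attractor n) = (packingDim (S.attractor n) : EReal) := by
  refine le_antisymm (upperBoxDim_le_packingDim_of_cover (S.attractor_nonempty n) ?_)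
    (packingDim_le_upperBoxDim (S.attractor_nonempty n))
  intro t hclosed hcover
  obtain ⟨i, k, σ, h⟩ := S.exists_iter_image_subset hclosed hcover
  refine ⟨i, ?_⟩
  rw [hS.upperBoxDim_attractor n, ← hS.upperBoxDim_attractor (n + k)]
  -- The closed set `t i` is arbitrary; intersecting it with the attractor supplies total
  -- boundedness.
  exact (hS.upperBoxDim_le_of_iter
    ((S.totallyBounded_attractor n).subset inter_subset_right) h).trans
    (upperBoxDim_mono inter_subset_left)

end IsSelfSimilar

end MIFS

/-! ### Counting maps -/

/-- The sum of the indicators of the `W i` is at most `γ` times the indicator of `B`; integrate. -/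
lemma sum_measure_le_of_card_le {α ι : Type*} [MeasurableSpace α] {μ : Measure α} {T : Finset ι}
    {W : ι → Set α} {B : Set α} (hW : ∀ i ∈ T, MeasurableSet (W i)) (hB : MeasurableSet B)
    (hWB : ∀ i ∈ T, W i ⊆ B) {γ : ℕ} (h : ∀ z, {i | i ∈ T ∧ z ∈ W i}.encard ≤ γ) :
    ∑ i ∈ T, μ (W i) ≤ γ * μ B := by
  classical
  calc ∑ i ∈ T, μ (W i) = ∑ i ∈ T, ∫⁻ z, (W i).indicator 1 z ∂μ :=
        Finset.sum_congr rfl fun i hi => (lintegral_indicator_one (hW i hi)).symm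
    _ = ∫⁻ z, ∑ i ∈ T, (W i).indicator 1 z ∂μ :=
        (lintegral_finsetSum' _ fun i hi => (measurable_one.indicator (hW i hi)).aemeasurable).symm
    _ ≤ ∫⁻ z, B.indicator (fun _ => (γ : ℝ≥0∞)) z ∂μ := by
        refine lintegral_mono fun z => ?_
        by_cases hz : z ∈ B
        · rw [indicator_of_mem hz]
          simp only [indicator_apply, Pi.one_apply, Finset.sum_boole]
          have := h z
          rw [show {i | i ∈ T ∧ z ∈ W i} = (T.filter fun i => z ∈ W i : Finset ι) by
            ext; simp, encard_coe_eq_coe_finsetCard] at this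
          exact_mod_cast this
        · rw [Finset.sum_eq_zero fun i hi => indicator_of_notMem (fun h => hz (hWB i hi h)) _]
          exact zero_le
    _ = γ * μ B := lintegral_indicator_const hB _

lemma encard_biUnion_le_mul {α β : Type*} {C : Set α} (hC : C.Finite) {s : α → Set β} {M : ℕ}
    (h : ∀ y ∈ C, (s y).encard ≤ M) : (⋃ y ∈ C, s y).encard ≤ M * C.encard := by
  induction C, hC using Set.Finite.induction_on with
  | empty => simp
  | @insert a C ha hC ih =>
    rw [biUnion_insert, encard_insert_of_notMem ha, mul_add, mul_one, add_comm]
    exact (encard_union_le _ _).trans (add_le_add (h a (mem_insert a C))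
      (ih fun y hy => h y (mem_insert_of_mem a hy)))

open scoped Pointwise in
lemma measurableSet_volume_image_similarity {d : ℕ} {ρ : ℝ} (hρ : 0 < ρ)
    (L : EuclideanSpace ℝ (Fin d) ≃ₗᵢ[ℝ] EuclideanSpace ℝ (Fin d))
    (c : EuclideanSpace ℝ (Fin d)) {A : Set (EuclideanSpace ℝ (Fin d))} (hA : MeasurableSet A) :
    MeasurableSet ((fun x => ρ • L x + c) '' A) ∧
      volume ((fun x => ρ • L x + c) '' A) = ENNReal.ofReal (ρ ^ d) * volume A := by
  have h1 : L '' A = L.symm ⁻¹' A := L.toEquiv.image_eq_preimage_symm A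
  have hm1 : MeasurableSet (L '' A) := by
    rw [h1]
    exact L.symm.continuous.measurable hA
  have hv1 : volume (L '' A) = volume A := by
    rw [h1, L.symm.measurePreserving.measure_preimage hA.nullMeasurableSet]
  have h2 : (fun x => ρ • L x + c) '' A = (fun x => x + c) '' (ρ • (L '' A)) := by
    rw [← image_smul, image_image, image_image]
  rw [h2, image_add_right]
  refine ⟨measurable_add_const _ (hm1.const_smul₀ ρ), ?_⟩
  rw [measure_preimage_add_right, Measure.addHaar_smul, hv1, finrank_euclideanSpace_fin,
    abs_of_pos (pow_pos hρ d)]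

namespace MIFS

variable {d : ℕ} {X : Set (EuclideanSpace ℝ (Fin d))} {S : MIFS X}
  {r : (n : ℕ) → Fin (S.N n) → ℝ}

/-- For `d ≥ 1` a set with at most one point is Lebesgue null, whereas `U 0` has positive measure.
-/
lemma MWSC.nontrivial (hd : 1 ≤ d) (h : S.MWSC) : Nontrivial X := by
  have : Nonempty (Fin d) := ⟨⟨0, hd⟩⟩
  obtain ⟨U, -, hpos, -⟩ := h
  rw [nontrivial_coe_sort, ← not_subsingleton_iff]
  intro hX
  have hsub : ((↑) '' U 0 : Set (EuclideanSpace ℝ (Fin d))).Subsingleton :=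
    hX.anti (Subtype.coe_image_subset X (U 0))
  exact absurd (hsub.measure_zero volume) (hpos.trans_le (iInf_le _ 0)).ne'

lemma dist_le_diam (S : MIFS X) (x y : X) : dist x y ≤ Metric.diam X :=
  Metric.dist_le_diam_of_mem S.isCompact.isBounded x.2 y.2

namespace IsSelfSimilar

/-- The balls are centred at `f x₀`, so words with the same map share a ball. This is why maps
rather than words are counted. -/
lemma boxCount_le_encard_cutMaps [Nontrivial X] (hS : S.IsSelfSimilar r) {b : ℝ} (hb0 : 0 < b)
    (hb1 : b < 1) {D : ℝ} (hD : Metric.diam X ≤ D) :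
    boxCount (S.attractor 0) (D * b) ≤ (S.cutMaps b).encard := by
  obtain ⟨x₀⟩ : Nonempty X := inferInstance
  refine (boxCount_le_encard
    (C := (fun f : X → X => (f x₀ : EuclideanSpace ℝ (Fin d))) '' S.cutMaps b) ?_).trans
    (encard_image_le _ _)
  rw [attractor_eq_range]
  rintro _ ⟨σ, rfl⟩
  obtain ⟨k, hk⟩ := hS.exists_take_mem_cutWords σ hb0 hb1
  refine mem_iUnion₂.2 ⟨_, mem_image_of_mem _ ⟨_, hk, rfl⟩, ?_⟩
  simp only [Metric.mem_closedBall, ← Subtype.dist_eq]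
  rw [S.code_eq_iter σ 0 (k + 1), iter, hS.dist_wordMap, mul_comm D]
  exact mul_le_mul ((hS.take_mem_cutWords_iff σ k b).1 hk).1 ((S.dist_le_diam _ _).trans hD)
    dist_nonneg hb0.le

/-- The weak separation condition bounds the number of maps whose image meets a given ball. -/
lemma exists_encard_hitting_le (hS : S.IsSelfSimilar r) (hW : S.MWSC) {C : ℝ} (hC : 0 ≤ C) :
    ∃ M : ℕ, ∀ b ∈ Ioo (0 : ℝ) 1, ∀ p : ℝ, 0 < p →
      (∀ J ∈ S.cutWords b, p ≤ J.2.weight r ∧ J.2.weight r ≤ C * p) →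
      ∀ y : EuclideanSpace ℝ (Fin d),
        {f | f ∈ S.cutMaps b ∧
          ∃ x : X, dist (f x : EuclideanSpace ℝ (Fin d)) y ≤ p}.encard ≤ M := by
  obtain ⟨U, hmeas, hpos, γ, hγ⟩ := hW
  set u := ⨅ n, volume ((↑) '' U n : Set (EuclideanSpace ℝ (Fin d))) with hu
  set D := Metric.diam X with hD
  have hD0 : 0 ≤ D := Metric.diam_nonneg
  -- Measurable subsets of full measure replace the null measurable sets `U n`; shrinking preserves
  -- the overlap bound.
  have hV : ∀ n, ∃ V : Set X, V ⊆ U n ∧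
      MeasurableSet ((↑) '' V : Set (EuclideanSpace ℝ (Fin d))) ∧
      u ≤ volume ((↑) '' V : Set (EuclideanSpace ℝ (Fin d))) := by
    intro n
    obtain ⟨A, hAU, hA, hae⟩ := (hmeas n).exists_measurable_subset_ae_eq
    have hAX : (↑) '' ((↑) ⁻¹' A : Set X) = A := by
      rw [Subtype.image_preimage_coe, inter_eq_right]
      exact hAU.trans (Subtype.coe_image_subset X (U n))
    refine ⟨(↑) ⁻¹' A, fun x hx => ?_, by rwa [hAX], ?_⟩
    · obtain ⟨x', hx', h⟩ := hAU hx
      rwa [← Subtype.ext h]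
    · rw [hAX, measure_congr hae]
      exact iInf_le _ n
  choose V hVU hVm hVu using hV
  -- `p ^ d * Q` is `γ` times the volume of the ball of radius `p * (1 + C * D)` that will contain
  -- all the copies, each of volume at least `p ^ d * u`; hence the choice `M > Q / u`.
  set Q : ℝ≥0∞ := γ * (ENNReal.ofReal ((1 + C * D) ^ d) *
    volume (Metric.ball (0 : EuclideanSpace ℝ (Fin d)) 1)) with hQ
  have hQtop : Q ≠ ⊤ := ENNReal.mul_ne_top (ENNReal.natCast_ne_top γ)
    (ENNReal.mul_ne_top ENNReal.ofReal_ne_top measure_ball_lt_top.ne)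
  obtain ⟨M, hM⟩ := ENNReal.exists_nat_gt (ENNReal.div_ne_top hQtop hpos.ne')
  refine ⟨M, fun b hb p hp hJ y => ?_⟩
  by_contra! hlt
  -- Finiteness is not known in advance, so the volume argument is applied to `M + 1` of the maps.
  obtain ⟨t, htsub, htcard⟩ := exists_subset_encard_eq (Order.add_one_le_of_lt hlt)
  have htfin : t.Finite := finite_of_encard_eq_coe (k := M + 1) (by exact_mod_cast htcard)
  obtain ⟨T, rfl⟩ := htfin.exists_finset_coe
  rw [encard_coe_eq_coe_finsetCard] at htcard
  have hTcard : T.card = M + 1 := by exact_mod_cast htcard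
  have hword : ∀ f : X → X, ∃ J : Σ k, MoranWord S.N 0 (k + 1),
      f ∈ T → J ∈ S.cutWords b ∧ S.wordMap J.2 = f := by
    intro f
    by_cases hf : f ∈ T
    · obtain ⟨J, hJ1, hJ2⟩ := (htsub hf).1
      exact ⟨J, fun _ => ⟨hJ1, hJ2⟩⟩
    · exact ⟨⟨0, MoranWord.take (fun i => ⟨0, S.N_pos i⟩) 0 1⟩, fun h => absurd h hf⟩
  choose J hJ' using hword
  set W : (X → X) → Set (EuclideanSpace ℝ (Fin d)) :=
    fun f => (↑) '' (S.wordMap (J f).2 '' V ((J f).1 + 1)) with hWdef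
  have hWm : ∀ f ∈ T, MeasurableSet (W f) ∧ ENNReal.ofReal (p ^ d) * u ≤ volume (W f) := by
    intro f hf
    obtain ⟨L, c, hL⟩ := hS.wordMap_extension (J f).2
    have hWG : W f = (fun x => (J f).2.weight r • L x + c) '' ((↑) '' V ((J f).1 + 1)) := by
      simp only [hWdef, image_image, hL]
    obtain ⟨h1, h2⟩ := measurableSet_volume_image_similarity (hS.weight_pos (J f).2) L c
      (hVm ((J f).1 + 1))
    rw [hWG]
    refine ⟨h1, ?_⟩
    rw [h2]
    gcongr
    · exact (hJ _ (hJ' f hf).1).1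
    · exact hVu _
  have hWB : ∀ f ∈ T, W f ⊆ Metric.closedBall y (p * (1 + C * D)) := by
    rintro f hf _ ⟨_, ⟨v, hv, rfl⟩, rfl⟩
    obtain ⟨x, hx⟩ := (htsub hf).2
    rw [Metric.mem_closedBall]
    refine (dist_triangle _ (f x : EuclideanSpace ℝ (Fin d)) _).trans ?_
    have h1 : dist (S.wordMap (J f).2 v) (f x) ≤ C * p * D := by
      have e : f x = S.wordMap (J f).2 x := by rw [(hJ' f hf).2]
      rw [e, hS.dist_wordMap]
      exact mul_le_mul (hJ _ (hJ' f hf).1).2 (S.dist_le_diam _ _) dist_nonneg (by positivity)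
    rw [Subtype.dist_eq] at h1
    linarith
  -- All maps whose copies contain `z` are neighbours, in the sense of the separation condition, of
  -- any single one of them.
  have hcount : ∀ z, {f | f ∈ T ∧ z ∈ W f}.encard ≤ γ := by
    intro z
    rcases eq_empty_or_nonempty {f | f ∈ T ∧ z ∈ W f} with h0 | ⟨g, hg, hzg⟩
    · simp [h0]
    · refine (encard_le_encard ?_).trans (hγ b hb (J g) (hJ' g hg).1)
      rintro f ⟨hf, hzf⟩
      refine ⟨J f, (hJ' f hf).1, (hJ' f hf).2, ?_⟩
      obtain ⟨z₁, hz₁, rfl⟩ := hzf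
      obtain ⟨z₂, hz₂, hz⟩ := hzg
      rw [Subtype.ext hz] at hz₂
      exact ⟨z₁, image_mono (hVU _) hz₁, image_mono (hVU _) hz₂⟩
  have hsum := sum_measure_le_of_card_le (μ := volume) (fun f hf => (hWm f hf).1)
    Metric.isClosed_closedBall.measurableSet hWB hcount
  have hlow : (T.card : ℝ≥0∞) * (ENNReal.ofReal (p ^ d) * u) ≤ ∑ f ∈ T, volume (W f) := by
    rw [← nsmul_eq_mul]
    exact Finset.card_nsmul_le_sum _ _ _ fun f hf => (hWm f hf).2
  have hball : (γ : ℝ≥0∞) * volume (Metric.closedBall y (p * (1 + C * D))) =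
      ENNReal.ofReal (p ^ d) * Q := by
    rw [Measure.addHaar_closedBall _ _ (by positivity), finrank_euclideanSpace_fin, mul_pow,
      ENNReal.ofReal_mul (by positivity), hQ]
    ring
  have hkey : ENNReal.ofReal (p ^ d) * (T.card * u) ≤ ENNReal.ofReal (p ^ d) * Q := by
    calc ENNReal.ofReal (p ^ d) * (T.card * u) = T.card * (ENNReal.ofReal (p ^ d) * u) := by ring
      _ ≤ _ := hlow.trans (hsum.trans_eq hball)
  rw [ENNReal.mul_le_mul_iff_right (ENNReal.ofReal_pos.2 (by positivity)).ne' ENNReal.ofReal_ne_top]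
    at hkey
  have hle : (T.card : ℝ≥0∞) ≤ Q / u :=
    (ENNReal.le_div_iff_mul_le (Or.inl hpos.ne') (Or.inr hQtop)).2 hkey
  have : T.card < M := by exact_mod_cast hle.trans_lt hM
  omega

/-- Each map of the cut sends the code of a tail to a point of the attractor, so its image meets a
ball of an optimal cover; each ball is met by at most `M` images. -/
lemma exists_encard_cutMaps_le [Nontrivial X] (hS : S.IsSelfSimilar r) (hW : S.MWSC) {C : ℝ}
    (hC : 0 ≤ C) :
    ∃ M : ℕ, ∀ b ∈ Ioo (0 : ℝ) 1, ∀ p : ℝ, 0 < p →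
      (∀ J ∈ S.cutWords b, p ≤ J.2.weight r ∧ J.2.weight r ≤ C * p) →
      (S.cutMaps b).encard ≤ M * boxCount (S.attractor 0) p := by
  obtain ⟨M, hM⟩ := hS.exists_encard_hitting_le hW hC
  refine ⟨M, fun b hb p hp hJ => ?_⟩
  obtain ⟨Z, hZ, hcard⟩ := exists_boxCount_eq_encard (F := S.attractor 0) hp.le
  have hfin : Z.Finite := by
    rw [← encard_ne_top_iff, hcard]
    exact boxCount_ne_top (S.totallyBounded_attractor 0) hp
  rw [← hcard]
  refine le_trans (encard_le_encard ?_) (encard_biUnion_le_mul hfin fun y _ => hM b hb p hp hJ y)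
  rintro _ ⟨⟨k, J⟩, hJb, rfl⟩
  obtain ⟨σ, rfl⟩ := MoranWord.exists_take_eq S.N_pos J
  obtain ⟨y, hy, hyball⟩ := mem_iUnion₂.1 (hZ (S.code_mem_attractor σ 0))
  refine mem_iUnion₂.2 ⟨y, hy, ⟨_, hJb, rfl⟩, S.code σ (0 + (k + 1)), ?_⟩
  rw [S.code_eq_iter σ 0 (k + 1), Metric.mem_closedBall] at hyball
  exact hyball

end IsSelfSimilar

end MIFS

namespace MIFS

variable {d : ℕ} {X : Set (EuclideanSpace ℝ (Fin d))} {S : MIFS X}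
  {r : (n : ℕ) → Fin (S.N n) → ℝ}

namespace IsSelfSimilar

/-! ### Box dimensions from the counts of maps -/

lemma encard_cutMaps_ne_zero [Nontrivial X] (hS : S.IsSelfSimilar r) {b : ℝ} (hb0 : 0 < b)
    (hb1 : b < 1) : (S.cutMaps b).encard ≠ 0 := fun h0 =>
  boxCount_ne_zero (S.attractor_nonempty 0) _
    (nonpos_iff_eq_zero.1 ((hS.boxCount_le_encard_cutMaps hb0 hb1 le_rfl).trans_eq h0))

/-- Scales `g b`, comparable to the ratios of all the words in `cutWords b`, and a scale `h δ` with
`δ ≤ g (h δ)`, both logarithmically equivalent to the given one. -/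
structure CutScales (S : MIFS X) (r : (n : ℕ) → Fin (S.N n) → ℝ) (g h : ℝ → ℝ) : Prop where
  weight_bounds : ∃ C : ℝ, 0 ≤ C ∧ ∀ᶠ b in 𝓝[>] 0, ∀ J ∈ S.cutWords b,
    g b ≤ J.2.weight r ∧ J.2.weight r ≤ C * g b
  tendsto_g : Tendsto g (𝓝[>] 0) (𝓝[>] 0)
  log_g : Tendsto (fun b => Real.log b / Real.log (g b)) (𝓝[>] 0) (𝓝 1)
  tendsto_h : Tendsto h (𝓝[>] 0) (𝓝[>] 0)
  log_h : Tendsto (fun δ => Real.log (h δ) / Real.log δ) (𝓝[>] 0) (𝓝 1)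
  le_g_h : ∀ᶠ δ in 𝓝[>] 0, δ ≤ g (h δ)

variable {g h : ℝ → ℝ}

lemma exists_eventually_encard_cutMaps_le [Nontrivial X] (hS : S.IsSelfSimilar r) (hW : S.MWSC)
    (hgh : CutScales S r g h) : ∃ M : ℕ, ∀ᶠ b in 𝓝[>] 0,
      (S.cutMaps b).encard ≤ M * boxCount (S.attractor 0) (g b) := by
  obtain ⟨C, hC, hev⟩ := hgh.weight_bounds
  obtain ⟨M, hM⟩ := hS.exists_encard_cutMaps_le hW hC
  refine ⟨M, ?_⟩
  filter_upwards [hev, hgh.tendsto_g self_mem_nhdsWithin, Ioo_mem_nhdsGT (one_pos : (0 : ℝ) < 1)]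
    with b hb hg hb1
  exact hM b hb1 (g b) hg hb

lemma eventually_encard_cutMaps_ne_top [Nontrivial X] (hS : S.IsSelfSimilar r) (hW : S.MWSC)
    (hgh : CutScales S r g h) : ∀ᶠ b in 𝓝[>] 0, (S.cutMaps b).encard ≠ ⊤ := by
  obtain ⟨M, hM⟩ := hS.exists_eventually_encard_cutMaps_le hW hgh
  filter_upwards [hM, hgh.tendsto_g self_mem_nhdsWithin] with b hb hg
  exact ne_top_of_le_ne_top (WithTop.mul_ne_top (ENat.natCast_ne_top M)
    (boxCount_ne_top (S.totallyBounded_attractor 0) hg)) hb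

lemma eventually_encard_cutMaps_ne_zero [Nontrivial X] (hS : S.IsSelfSimilar r) :
    ∀ᶠ b in 𝓝[>] 0, (S.cutMaps b).encard ≠ 0 := by
  filter_upwards [Ioo_mem_nhdsGT (one_pos : (0 : ℝ) < 1)] with b hb
  exact hS.encard_cutMaps_ne_zero hb.1 hb.2

/-- For `liminf` the cut has to be reparametrised, which is the role of `h`: `#A_{h δ} ≤ M * N_{g (h
δ)} ≤ M * N_δ`. For `limsup` the scale `g` alone suffices. -/
theorem lowerBoxDim_eq_liminf_cutQuotient [Nontrivial X] (hS : S.IsSelfSimilar r) (hW : S.MWSC)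
    (hgh : CutScales S r g h) (n : ℕ) :
    lowerBoxDim (S.attractor n) = liminf S.cutQuotient (𝓝[>] 0) := by
  rw [hS.lowerBoxDim_attractor n, lowerBoxDim_eq]
  obtain ⟨M, hM⟩ := hS.exists_eventually_encard_cutMaps_le hW hgh
  have hD : 0 < Metric.diam X + 1 := by positivity
  refine le_antisymm ?_ ?_
  · have hdom : GrowthDominated (𝓝[>] (0 : ℝ))
        (fun b => boxCount (S.attractor 0) ((Metric.diam X + 1) * b))
        (fun b => (Metric.diam X + 1) * b) (fun b => (S.cutMaps b).encard) (fun b => b) := by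
      refine ⟨?_, ⟨1, ?_⟩, hS.eventually_encard_cutMaps_ne_top hW hgh, tendsto_id,
        tendsto_log_const_mul_div_log hD⟩
      · filter_upwards with b using boxCount_ne_zero (S.attractor_nonempty 0) _
      · filter_upwards [Ioo_mem_nhdsGT (one_pos : (0 : ℝ) < 1)] with b hb
        simpa using hS.boxCount_le_encard_cutMaps hb.1 hb.2 (by linarith)
    exact (liminf_le_liminf_comp (u := fun b => growth (boxCount (S.attractor 0) b) b)
      (tendsto_const_mul_nhdsGT_zero hD)).trans hdom.liminf_le
  · have hdom : GrowthDominated (𝓝[>] (0 : ℝ)) (fun δ => (S.cutMaps (h δ)).encard) h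
        (fun δ => boxCount (S.attractor 0) δ) (fun δ => δ) := by
      refine ⟨hgh.tendsto_h.eventually hS.eventually_encard_cutMaps_ne_zero, ⟨M, ?_⟩, ?_,
        tendsto_id, hgh.log_h⟩
      · filter_upwards [hgh.tendsto_h.eventually hM, hgh.le_g_h] with δ h1 h2
        exact h1.trans (mul_le_mul_right (boxCount_anti _ h2) _)
      · filter_upwards [self_mem_nhdsWithin] with b hb
        exact boxCount_ne_top (S.totallyBounded_attractor 0) hb
    exact (liminf_le_liminf_comp (u := S.cutQuotient) hgh.tendsto_h).trans hdom.liminf_le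

theorem upperBoxDim_eq_limsup_cutQuotient [Nontrivial X] (hS : S.IsSelfSimilar r) (hW : S.MWSC)
    (hgh : CutScales S r g h) (n : ℕ) :
    upperBoxDim (S.attractor n) = limsup S.cutQuotient (𝓝[>] 0) := by
  rw [hS.upperBoxDim_attractor n, upperBoxDim_eq]
  obtain ⟨M, hM⟩ := hS.exists_eventually_encard_cutMaps_le hW hgh
  have hD : 0 < Metric.diam X + 1 := by positivity
  have hDinv := tendsto_const_mul_nhdsGT_zero (inv_pos.2 hD)
  refine le_antisymm ?_ ?_
  · have hdom : GrowthDominated (𝓝[>] (0 : ℝ)) (fun δ => boxCount (S.attractor 0) δ) (fun δ => δ)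
        (fun δ => (S.cutMaps ((Metric.diam X + 1)⁻¹ * δ)).encard)
        (fun δ => (Metric.diam X + 1)⁻¹ * δ) := by
      refine ⟨?_, ⟨1, ?_⟩, hDinv.eventually (hS.eventually_encard_cutMaps_ne_top hW hgh), hDinv,
        tendsto_log_div_log_const_mul (inv_pos.2 hD)⟩
      · filter_upwards with b using boxCount_ne_zero (S.attractor_nonempty 0) _
      · filter_upwards [hDinv (Ioo_mem_nhdsGT (one_pos : (0 : ℝ) < 1))] with δ hδ
        have := hS.boxCount_le_encard_cutMaps hδ.1 hδ.2 (D := Metric.diam X + 1) (by linarith)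
        rw [mul_inv_cancel_left₀ hD.ne'] at this
        simpa using this
    exact hdom.limsup_le.trans (limsup_comp_le_limsup (u := S.cutQuotient) hDinv)
  · have hdom : GrowthDominated (𝓝[>] (0 : ℝ)) (fun b => (S.cutMaps b).encard) (fun b => b)
        (fun b => boxCount (S.attractor 0) (g b)) g := by
      refine ⟨hS.eventually_encard_cutMaps_ne_zero, ⟨M, hM⟩, ?_, hgh.tendsto_g, hgh.log_g⟩
      filter_upwards [hgh.tendsto_g self_mem_nhdsWithin] with b hb
      exact boxCount_ne_top (S.totallyBounded_attractor 0) hb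
    exact hdom.limsup_le.trans (limsup_comp_le_limsup
      (u := fun b => growth (boxCount (S.attractor 0) b) b) hgh.tendsto_g)

/-! ### Ratios bounded away from zero -/

/-- Without its last letter a cut word has weight above `b`, and that letter costs a factor of at
least `r₀`; so cut weights lie in `[r₀ * b, b]`. -/
lemma cutScales_of_iInf_pos [Nontrivial X] (hS : S.IsSelfSimilar r)
    (h0 : 0 < ⨅ p : (Σ n, Fin (S.N n)), r p.1 p.2) :
    CutScales S r (fun b => (⨅ p : (Σ n, Fin (S.N n)), r p.1 p.2) * b)
      (fun b => (⨅ p : (Σ n, Fin (S.N n)), r p.1 p.2)⁻¹ * b) := by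
  set r₀ := ⨅ p : (Σ n, Fin (S.N n)), r p.1 p.2 with hr₀
  have hle : ∀ n j, r₀ ≤ r n j := fun n j =>
    ciInf_le (f := fun p : (Σ n, Fin (S.N n)) => r p.1 p.2)
      ⟨0, by rintro _ ⟨p, rfl⟩; exact (hS.mem_Ioo _ _).1.le⟩ ⟨n, j⟩
  refine ⟨⟨r₀⁻¹, (inv_pos.2 h0).le, ?_⟩, tendsto_const_mul_nhdsGT_zero h0,
    tendsto_log_div_log_const_mul h0, tendsto_const_mul_nhdsGT_zero (inv_pos.2 h0),
    tendsto_log_const_mul_div_log (inv_pos.2 h0), ?_⟩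
  · filter_upwards [self_mem_nhdsWithin] with b hb
    rintro ⟨k, J⟩ hJ
    obtain ⟨σ, rfl⟩ := MoranWord.exists_take_eq S.N_pos J
    obtain ⟨h1, h2⟩ := (hS.take_mem_cutWords_iff σ k b).1 hJ
    refine ⟨?_, by rwa [inv_mul_cancel_left₀ h0.ne']⟩
    simp only [MoranWord.weight_take] at h2 ⊢
    rw [Finset.prod_range_succ, mul_comm]
    exact mul_le_mul h2.le (hle _ _) h0.le ((le_of_lt hb).trans h2.le)
  · filter_upwards with b
    rw [mul_inv_cancel_left₀ h0.ne']

/-! ### Equal ratios in each layer -/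

section EqualRatios

variable {q : ℕ → ℝ}

lemma weight_take_of_eq (hq : ∀ n j, r n j = q n) (σ : ∀ i, Fin (S.N i)) (k : ℕ) :
    (MoranWord.take σ 0 k).weight r = ∏ i ∈ Finset.range k, q i := by
  simp [MoranWord.weight_take, hq]

lemma mem_Ioo_of_eq (hS : S.IsSelfSimilar r) (hq : ∀ n j, r n j = q n) (n : ℕ) :
    q n ∈ Ioo (0 : ℝ) 1 := by
  rw [← hq n ⟨0, S.N_pos n⟩]
  exact hS.mem_Ioo n _

lemma strictAnti_prod (hS : S.IsSelfSimilar r) (hq : ∀ n j, r n j = q n) :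
    StrictAnti fun m => ∏ i ∈ Finset.range m, q i := by
  refine strictAnti_nat_of_succ_lt fun m => ?_
  rw [Finset.prod_range_succ]
  exact mul_lt_of_lt_one_right
    (Finset.prod_pos fun i _ => (hS.mem_Ioo_of_eq hq i).1) (hS.mem_Ioo_of_eq hq m).2

lemma tendsto_prod [Nontrivial X] (hS : S.IsSelfSimilar r) (hq : ∀ n j, r n j = q n) :
    Tendsto (fun m => ∏ i ∈ Finset.range m, q i) atTop (𝓝[>] 0) := by
  refine tendsto_nhdsWithin_iff.2 ⟨?_, Eventually.of_forall fun m =>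
    Finset.prod_pos fun i _ => (hS.mem_Ioo_of_eq hq i).1⟩
  exact (hS.tendsto_weight_take (fun i => ⟨0, S.N_pos i⟩) 0).congr (weight_take_of_eq hq _)

/-- The length, less one, of the words in `cutWords b`. -/
lemma exists_cut_level [Nontrivial X] (hS : S.IsSelfSimilar r) (hq : ∀ n j, r n j = q n) :
    ∃ m : ℝ → ℕ, ∀ b ∈ Ioo (0 : ℝ) 1,
      ∏ i ∈ Finset.range (m b + 1), q i ≤ b ∧ b < ∏ i ∈ Finset.range (m b), q i := by
  have : ∀ b : ℝ, ∃ m : ℕ, b ∈ Ioo (0 : ℝ) 1 →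
      ∏ i ∈ Finset.range (m + 1), q i ≤ b ∧ b < ∏ i ∈ Finset.range m, q i := by
    intro b
    by_cases hb : b ∈ Ioo (0 : ℝ) 1
    · obtain ⟨k, hk⟩ := hS.exists_take_mem_cutWords (fun i => ⟨0, S.N_pos i⟩) hb.1 hb.2
      rw [hS.take_mem_cutWords_iff, weight_take_of_eq hq, weight_take_of_eq hq] at hk
      exact ⟨k, fun _ => hk⟩
    · exact ⟨0, fun h => absurd h hb⟩
  choose m hm using this
  exact ⟨m, hm⟩

lemma mem_cutWords_iff_of_eq [Nontrivial X] (hS : S.IsSelfSimilar r) (hq : ∀ n j, r n j = q n)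
    {m : ℕ} {b : ℝ} (hb : ∏ i ∈ Finset.range (m + 1), q i ≤ b ∧ b < ∏ i ∈ Finset.range m, q i)
    (J : Σ k, MoranWord S.N 0 (k + 1)) : J ∈ S.cutWords b ↔ J.1 = m := by
  obtain ⟨k, J⟩ := J
  obtain ⟨σ, rfl⟩ := MoranWord.exists_take_eq S.N_pos J
  rw [hS.take_mem_cutWords_iff, weight_take_of_eq hq, weight_take_of_eq hq]
  have hanti := hS.strictAnti_prod hq
  constructor
  · rintro ⟨h1, h2⟩
    have h3 := hanti.lt_iff_gt.1 (h1.trans_lt hb.2)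
    have h4 := hanti.lt_iff_gt.1 (hb.1.trans_lt h2)
    change k = m
    omega
  · rintro rfl
    exact hb

lemma cutMaps_eq_of_eq [Nontrivial X] (hS : S.IsSelfSimilar r) (hq : ∀ n j, r n j = q n)
    {m : ℕ} {b : ℝ} (hb : ∏ i ∈ Finset.range (m + 1), q i ≤ b ∧ b < ∏ i ∈ Finset.range m, q i) :
    S.cutMaps (∏ i ∈ Finset.range (m + 1), q i) = S.cutMaps b := by
  have : S.cutWords (∏ i ∈ Finset.range (m + 1), q i) = S.cutWords b := by
    ext J
    rw [hS.mem_cutWords_iff_of_eq hq hb, hS.mem_cutWords_iff_of_eq hq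
      ⟨le_rfl, hS.strictAnti_prod hq m.lt_succ_self⟩]
  rw [cutMaps, cutMaps, this]

lemma tendsto_cut_level (hS : S.IsSelfSimilar r) (hq : ∀ n j, r n j = q n) {m : ℝ → ℕ}
    (hm : ∀ b ∈ Ioo (0 : ℝ) 1,
      ∏ i ∈ Finset.range (m b + 1), q i ≤ b ∧ b < ∏ i ∈ Finset.range (m b), q i) :
    Tendsto m (𝓝[>] 0) atTop := by
  refine tendsto_atTop.2 fun M => ?_
  have hpos : 0 < ∏ i ∈ Finset.range M, q i :=
    Finset.prod_pos fun i _ => (hS.mem_Ioo_of_eq hq i).1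
  filter_upwards [Ioo_mem_nhdsGT (lt_min hpos one_pos)] with b hb
  have h1 := (hm b ⟨hb.1, hb.2.trans_le (min_le_right _ _)⟩).1
  have h2 := (hS.strictAnti_prod hq).lt_iff_gt.1 (h1.trans_lt (hb.2.trans_le (min_le_left _ _)))
  omega

/-- The quotient is the inverse of `1 + log (q m) / log (q 0 ⋯ q (m - 1))`. The index `m = 0` is
excluded because the empty product has logarithm zero. -/
lemma tendsto_log_prod_ratio (hS : S.IsSelfSimilar r) (hq : ∀ n j, r n j = q n)
    (hlim : Tendsto (fun n => Real.log (q n) / Real.log (∏ i ∈ Finset.range n, q i)) atTop (𝓝 0)) :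
    Tendsto (fun m => Real.log (∏ i ∈ Finset.range m, q i) /
      Real.log (∏ i ∈ Finset.range (m + 1), q i)) atTop (𝓝 1) := by
  have h1 := (hlim.const_add 1).inv₀ (by norm_num)
  simp only [add_zero, inv_one] at h1
  refine h1.congr' ?_
  filter_upwards [eventually_gt_atTop 0] with m hm
  have hpos : 0 < ∏ i ∈ Finset.range m, q i :=
    Finset.prod_pos fun i _ => (hS.mem_Ioo_of_eq hq i).1
  have hlt : ∏ i ∈ Finset.range m, q i < 1 := by
    simpa using hS.strictAnti_prod hq hm
  have hlog := Real.log_neg hpos hlt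
  rw [Finset.prod_range_succ, Real.log_mul hpos.ne' (hS.mem_Ioo_of_eq hq m).1.ne',
    one_add_div hlog.ne, inv_div]

/-- Logarithms of a scale and of the two products of ratios around it. -/
lemma tendsto_log_cut_level [Nontrivial X] (hS : S.IsSelfSimilar r) (hq : ∀ n j, r n j = q n)
    (hlim : Tendsto (fun n => Real.log (q n) / Real.log (∏ i ∈ Finset.range n, q i)) atTop (𝓝 0))
    {m : ℝ → ℕ} (hm : ∀ b ∈ Ioo (0 : ℝ) 1,
      ∏ i ∈ Finset.range (m b + 1), q i ≤ b ∧ b < ∏ i ∈ Finset.range (m b), q i) :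
    Tendsto (fun b => Real.log b / Real.log (∏ i ∈ Finset.range (m b + 1), q i)) (𝓝[>] 0) (𝓝 1) ∧
    Tendsto (fun b => Real.log (∏ i ∈ Finset.range (m b), q i) / Real.log b) (𝓝[>] 0) (𝓝 1) := by
  have hpos : ∀ k, 0 < ∏ i ∈ Finset.range k, q i := fun k =>
    Finset.prod_pos fun i _ => (hS.mem_Ioo_of_eq hq i).1
  have hratio := (hS.tendsto_log_prod_ratio hq hlim).comp (hS.tendsto_cut_level hq hm)
  have hbounds : ∀ᶠ b in 𝓝[>] (0 : ℝ), Real.log (∏ i ∈ Finset.range (m b + 1), q i) ≤ Real.log b ∧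
      Real.log b ≤ Real.log (∏ i ∈ Finset.range (m b), q i) ∧ Real.log b < 0 ∧
      Real.log (∏ i ∈ Finset.range (m b), q i) ≤ 0 := by
    filter_upwards [Ioo_mem_nhdsGT (one_pos : (0 : ℝ) < 1)] with b hb
    obtain ⟨h1, h2⟩ := hm b hb
    refine ⟨Real.log_le_log (hpos _) h1, Real.log_le_log hb.1 h2.le, Real.log_neg hb.1 hb.2,
      Real.log_nonpos (hpos _).le ?_⟩
    simpa using (hS.strictAnti_prod hq).antitone (Nat.zero_le (m b))
  constructor
  · refine tendsto_of_tendsto_of_tendsto_of_le_of_le' hratio tendsto_const_nhds ?_ ?_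
    · filter_upwards [hbounds] with b ⟨h1, h2, h3, h4⟩
      exact div_le_div_of_nonpos_of_le (h1.trans h3.le) h2
    · filter_upwards [hbounds] with b ⟨h1, h2, h3, h4⟩
      rw [div_le_one_of_neg (h1.trans_lt h3)]
      exact h1
  · refine tendsto_of_tendsto_of_tendsto_of_le_of_le' hratio tendsto_const_nhds ?_ ?_
    · filter_upwards [hbounds] with b ⟨h1, h2, h3, h4⟩
      simp only [Function.comp_apply]
      rw [← neg_div_neg_eq, ← neg_div_neg_eq (Real.log (∏ i ∈ Finset.range (m b), q i))]
      exact div_le_div_of_nonneg_left (by linarith) (by linarith) (by linarith)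
    · filter_upwards [hbounds] with b ⟨h1, h2, h3, h4⟩
      rw [div_le_one_of_neg h3]
      exact h2

/-- `g b` is the exact common weight of the cut words, so `C = 1`, and `h δ` is the product of
ratios one level above, which exceeds `δ`. -/
lemma cutScales_of_eq [Nontrivial X] (hS : S.IsSelfSimilar r) (hq : ∀ n j, r n j = q n)
    (hlim : Tendsto (fun n => Real.log (q n) / Real.log (∏ i ∈ Finset.range n, q i)) atTop (𝓝 0))
    {m : ℝ → ℕ} (hm : ∀ b ∈ Ioo (0 : ℝ) 1,
      ∏ i ∈ Finset.range (m b + 1), q i ≤ b ∧ b < ∏ i ∈ Finset.range (m b), q i) :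
    CutScales S r (fun b => ∏ i ∈ Finset.range (m b + 1), q i)
      (fun b => ∏ i ∈ Finset.range (m b), q i) := by
  have hlevel := hS.tendsto_cut_level hq hm
  have hlog := hS.tendsto_log_cut_level hq hlim hm
  have hIoo := Ioo_mem_nhdsGT (one_pos : (0 : ℝ) < 1)
  have htendsto_h := (hS.tendsto_prod hq).comp hlevel
  refine ⟨⟨1, zero_le_one, ?_⟩, (hS.tendsto_prod hq).comp
    ((tendsto_add_atTop_nat 1).comp hlevel), hlog.1, htendsto_h, hlog.2, ?_⟩
  · filter_upwards [hIoo] with b hb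
    rintro ⟨k, J⟩ hJ
    obtain rfl : k = m b := (hS.mem_cutWords_iff_of_eq hq (hm b hb) _).1 hJ
    obtain ⟨σ, rfl⟩ := MoranWord.exists_take_eq S.N_pos J
    simp [weight_take_of_eq hq]
  · filter_upwards [hIoo, htendsto_h hIoo] with δ hδ hh
    obtain ⟨h1, h2⟩ := hm _ hh
    -- The strict inequality in the cut at `h δ` forces `m (h δ) + 1 ≤ m δ`, so `g (h δ)` is at
    -- least the product at level `m δ`, which is above `δ`.
    have h3 := (hS.strictAnti_prod hq).lt_iff_gt.1 h2
    simp only [Function.comp_apply] at h1 h2 h3 ⊢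
    refine (hm δ hδ).2.le.trans ?_
    exact (hS.strictAnti_prod hq).antitone h3

/-- The cut at `b` coincides with the cut at the nearest product of ratios not exceeding `b`, and
the two scales are logarithmically equivalent. -/
lemma liminf_cutQuotient_eq_of_eq [Nontrivial X] (hS : S.IsSelfSimilar r) (hW : S.MWSC)
    (hq : ∀ n j, r n j = q n)
    (hlim : Tendsto (fun n => Real.log (q n) / Real.log (∏ i ∈ Finset.range n, q i)) atTop (𝓝 0))
    {m : ℝ → ℕ} (hm : ∀ b ∈ Ioo (0 : ℝ) 1,
      ∏ i ∈ Finset.range (m b + 1), q i ≤ b ∧ b < ∏ i ∈ Finset.range (m b), q i) :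
    liminf S.cutQuotient (𝓝[>] 0) =
      liminf (fun m => S.cutQuotient (∏ i ∈ Finset.range m, q i)) atTop := by
  refine le_antisymm (liminf_le_liminf_comp (hS.tendsto_prod hq)) ?_
  have hinv := (hS.tendsto_log_cut_level hq hlim hm).1.inv₀ one_ne_zero
  simp only [inv_div, inv_one] at hinv
  have hlevel := (tendsto_add_atTop_nat 1).comp (hS.tendsto_cut_level hq hm)
  have hdom : GrowthDominated (𝓝[>] (0 : ℝ))
      (fun b => (S.cutMaps (∏ i ∈ Finset.range (m b + 1), q i)).encard)
      (fun b => ∏ i ∈ Finset.range (m b + 1), q i)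
      (fun b => (S.cutMaps b).encard) (fun b => b) := by
    refine ⟨((hS.tendsto_prod hq).comp hlevel).eventually hS.eventually_encard_cutMaps_ne_zero,
      ⟨1, ?_⟩, hS.eventually_encard_cutMaps_ne_top hW (hS.cutScales_of_eq hq hlim hm),
      tendsto_id, hinv⟩
    filter_upwards [Ioo_mem_nhdsGT (one_pos : (0 : ℝ) < 1)] with b hb
    simp [hS.cutMaps_eq_of_eq hq (hm b hb)]
  exact (liminf_le_liminf_comp (u := fun m => S.cutQuotient (∏ i ∈ Finset.range m, q i))
    hlevel).trans hdom.liminf_le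

lemma limsup_cutQuotient_eq_of_eq [Nontrivial X] (hS : S.IsSelfSimilar r) (hW : S.MWSC)
    (hq : ∀ n j, r n j = q n)
    (hlim : Tendsto (fun n => Real.log (q n) / Real.log (∏ i ∈ Finset.range n, q i)) atTop (𝓝 0))
    {m : ℝ → ℕ} (hm : ∀ b ∈ Ioo (0 : ℝ) 1,
      ∏ i ∈ Finset.range (m b + 1), q i ≤ b ∧ b < ∏ i ∈ Finset.range (m b), q i) :
    limsup S.cutQuotient (𝓝[>] 0) =
      limsup (fun m => S.cutQuotient (∏ i ∈ Finset.range m, q i)) atTop := by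
  refine le_antisymm ?_ (limsup_comp_le_limsup (hS.tendsto_prod hq))
  have hlevel := (tendsto_add_atTop_nat 1).comp (hS.tendsto_cut_level hq hm)
  have hprod := (hS.tendsto_prod hq).comp hlevel
  have hdom : GrowthDominated (𝓝[>] (0 : ℝ)) (fun b => (S.cutMaps b).encard) (fun b => b)
      (fun b => (S.cutMaps (∏ i ∈ Finset.range (m b + 1), q i)).encard)
      (fun b => ∏ i ∈ Finset.range (m b + 1), q i) := by
    refine ⟨hS.eventually_encard_cutMaps_ne_zero, ⟨1, ?_⟩,
      hprod.eventually
        (hS.eventually_encard_cutMaps_ne_top hW (hS.cutScales_of_eq hq hlim hm)),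
      hprod, (hS.tendsto_log_cut_level hq hlim hm).1⟩
    filter_upwards [Ioo_mem_nhdsGT (one_pos : (0 : ℝ) < 1)] with b hb
    simp [hS.cutMaps_eq_of_eq hq (hm b hb)]
  exact hdom.limsup_le.trans (limsup_comp_le_limsup
    (u := fun m => S.cutQuotient (∏ i ∈ Finset.range m, q i)) hlevel)

end EqualRatios

end IsSelfSimilar

end MIFS

/-! ### Dimension formulas under the two hypotheses on the ratios -/

theorem theorem4p1 {d : ℕ} (hd : 1 ≤ d) {X : Set (EuclideanSpace ℝ (Fin d))} (S : MIFS X)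
    (r : (n : ℕ) → Fin (S.N n) → ℝ)
    (O : (n : ℕ) → Fin (S.N n) → EuclideanSpace ℝ (Fin d) ≃ₗᵢ[ℝ] EuclideanSpace ℝ (Fin d))
    (α : (n : ℕ) → Fin (S.N n) → EuclideanSpace ℝ (Fin d))
    (hr : ∀ n j, r n j ∈ Ioo (0 : ℝ) 1)
    (hφ : ∀ n j (x : X),
      (S.map n j x : EuclideanSpace ℝ (Fin d)) = r n j • O n j ((x : EuclideanSpace ℝ (Fin d)) + α n j))
    (hS : S.MWSC) :
    (0 < (⨅ p : (Σ n, Fin (S.N n)), r p.1 p.2) → ∀ n : ℕ,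
      lowerBoxDim (S.attractor n) = liminf S.cutQuotient (𝓝[>] 0) ∧
      liminf S.cutQuotient (𝓝[>] 0) ≤ limsup S.cutQuotient (𝓝[>] 0) ∧
      limsup S.cutQuotient (𝓝[>] 0) = upperBoxDim (S.attractor n) ∧
      upperBoxDim (S.attractor n) = (packingDim (S.attractor n) : EReal)) ∧
    (∀ q : ℕ → ℝ, (∀ n j, r n j = q n) →
      Tendsto (fun n => Real.log (q n) / Real.log (∏ i ∈ Finset.range n, q i)) atTop (𝓝 0) →
      ∀ n : ℕ,
        (lowerBoxDim (S.attractor n) = liminf S.cutQuotient (𝓝[>] 0) ∧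
          liminf S.cutQuotient (𝓝[>] 0) =
            liminf (fun m => S.cutQuotient (∏ i ∈ Finset.range m, q i)) atTop) ∧
        (upperBoxDim (S.attractor n) = (packingDim (S.attractor n) : EReal) ∧
          (packingDim (S.attractor n) : EReal) = limsup S.cutQuotient (𝓝[>] 0) ∧
          limsup S.cutQuotient (𝓝[>] 0) =
            limsup (fun m => S.cutQuotient (∏ i ∈ Finset.range m, q i)) atTop)) := by
  have : Nontrivial X := hS.nontrivial hd
  have hsim : S.IsSelfSimilar r := by
    refine ⟨hr, fun n j => ⟨O n j, r n j • O n j (α n j), fun x => ?_⟩⟩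
    rw [hφ, map_add, smul_add]
  refine ⟨fun h0 n => ?_, fun q hq hlim n => ?_⟩
  · have hscales := hsim.cutScales_of_iInf_pos h0
    exact ⟨hsim.lowerBoxDim_eq_liminf_cutQuotient hS hscales n, liminf_le_limsup,
      (hsim.upperBoxDim_eq_limsup_cutQuotient hS hscales n).symm,
      hsim.upperBoxDim_attractor_eq_packingDim n⟩
  · obtain ⟨m, hm⟩ := hsim.exists_cut_level hq
    have hscales := hsim.cutScales_of_eq hq hlim hm
    have hpack := hsim.upperBoxDim_attractor_eq_packingDim n
    exact ⟨⟨hsim.lowerBoxDim_eq_liminf_cutQuotient hS hscales n,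
      hsim.liminf_cutQuotient_eq_of_eq hS hq hlim hm⟩,
      hpack, hpack.symm.trans (hsim.upperBoxDim_eq_limsup_cutQuotient hS hscales n),
      hsim.limsup_cutQuotient_eq_of_eq hS hq hlim hm⟩
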